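/- Let $\mathcal R,\mathcal A$ be finite sets, let $p$ be a probability distribution on $\mathcal R\times\mathcal A$ with marginal $p(x)=\sum_a p(x,a)$ and conditional distributions $p(\cdot|x)$, and let $\rho_{RA}=\sum_{x,a}p(x,a)\,|x\rangle\langle x|_R\otimes|a\rangle\langle a|_A$ be the corresponding classical state, with reduced state $\rho_R=\operatorname{tr}_A\rho_{RA}$. Let $r\ge 0$ and, for $n\in\mathbb N$, let $\mathcal Z_n=\{1,\dots,\lfloor 2^{nr}\rfloor\}$. A function $f:\mathcal A^n\to\mathcal Z_n$ acts on operators by $\Phi_f(\omega)=\sum_{a\in\mathcal A^n}|f(a)\rangle\langle a|\,\omega\,|a\rangle\langle f(a)|$ (and as the identity on $R^n$). Let $F(\rho,\sigma)=\|\sqrt\rho\sqrt\sigma\|_1$ and let $P(\rho,\sigma)=\sqrt{1-F(\rho,\sigma)^2}$ be the purified distance. Then for every $n$ $$\varepsilon_n:=\inf_{f:\mathcal A^n\to\mathcal Z_n}P\Big(\Phi_f(\rho_{RA}^{\otimes n}),\ \rho_R^{\otimes n}\otimes\tfrac{I_{Z_n}}{|\mathcal Z_n|}\Big)<1,$$ and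 the strong converse exponent of privacy amplification exists and is $$\lim_{n\to\infty}\frac{-1}{n}\log(1-\varepsilon_n)=\sup_{\frac12\le\alpha\le1}\ \inf_{t\in\mathcal Q(\mathcal R)}\Big\{2D(t\|p)+\frac{1-\alpha}{\alpha}\Big(r-\mathbb E_{x\sim t}H_\alpha\big(p(\cdot|x)\big)\Big)\Big\}.$$ Here $\mathcal Q(\mathcal R)$ is the set of probability distributions on $\mathcal R$, logarithms are to base $2$, $D(t\|p)=\sum_x t(x)\log\frac{t(x)}{p(x)}$ if $p(x)=0$ implies $t(x)=0$ for all $x$ and $D(t\|p)=+\infty$ otherwise (in which case the expression in braces is $+\infty$), and $H_\alpha(q)=\frac1{1-\alpha}\log\sum_a q(a)^\alpha$ is the Rényi entropy, with $H_1$ the Shannon entropy. -/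

import Mathlib

open Filter Topology
open scoped Kronecker MatrixOrder ComplexOrder

namespace PrivacyAmplification

noncomputable section

/-! ### Operators on finite-dimensional systems

An operator on a system whose computational basis is the finite type `ι` is a matrix
`Matrix ι ι ℂ`; a bipartite system has a product type as its basis. -/

/-- The trace norm `‖X‖₁ = tr √(X* X)`. -/
def traceNorm {ι : Type*} [Fintype ι] [DecidableEq ι] (X : Matrix ι ι ℂ) : ℝ :=
  (Matrix.trace (CFC.sqrt (X.conjTranspose * X))).re

/-- The fidelity `F(ρ, σ) = ‖√ρ √σ‖₁`. -/
def fidelity {ι : Type*} [Fintype ι] [DecidableEq ι] (ρ σ : Matrix ι ι ℂ) : ℝ :=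
  traceNorm (CFC.sqrt ρ * CFC.sqrt σ)

/-- The purified distance `P(ρ, σ) = √(1 - F(ρ, σ)²)`. -/
def purifiedDistance {ι : Type*} [Fintype ι] [DecidableEq ι] (ρ σ : Matrix ι ι ℂ) : ℝ :=
  Real.sqrt (1 - fidelity ρ σ ^ 2)

/-- The `n`-fold tensor power of an operator. -/
def tensorPow {ι : Type*} (n : ℕ) (ρ : Matrix ι ι ℂ) :
    Matrix (Fin n → ι) (Fin n → ι) ℂ :=
  Matrix.of fun u v => ∏ i, ρ (u i) (v i)

/-- The `n`-fold tensor power of an operator on `RA`, as an operator on `Rⁿ Aⁿ`. -/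
def tensorPowBipartite {R A : Type*} (n : ℕ) (ρ : Matrix (R × A) (R × A) ℂ) :
    Matrix ((Fin n → R) × (Fin n → A)) ((Fin n → R) × (Fin n → A)) ℂ :=
  (tensorPow n ρ).submatrix (fun u i => (u.1 i, u.2 i)) (fun u i => (u.1 i, u.2 i))

/-- The reduced operator `ρ_R = tr_A ρ_{RA}`. -/
def reducedR {R A : Type*} [Fintype A] (ρ : Matrix (R × A) (R × A) ℂ) : Matrix R R ℂ :=
  Matrix.of fun x x' => ∑ a, ρ (x, a) (x', a)

/-- The classical state `∑ p(x,a) |x⟩⟨x| ⊗ |a⟩⟨a|` of a joint distribution `p`. -/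
def classicalState {R A : Type*} [DecidableEq R] [DecidableEq A] (p : R × A → ℝ) :
    Matrix (R × A) (R × A) ℂ :=
  Matrix.diagonal fun y => (p y : ℂ)

/-- The action `id_R ⊗ Φ_f` of a hash function `f : A → Z`, where
`Φ_f(ω) = ∑ₐ |f(a)⟩⟨a| ω |a⟩⟨f(a)|`. -/
def hashChannel {R A Z : Type*} [Fintype R] [Fintype A] [DecidableEq R] [DecidableEq A]
    [DecidableEq Z] (f : A → Z) (ω : Matrix (R × A) (R × A) ℂ) :
    Matrix (R × Z) (R × Z) ℂ :=
  ∑ a, ((1 : Matrix R R ℂ) ⊗ₖ Matrix.single (f a) a (1 : ℂ)) * ω *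
    ((1 : Matrix R R ℂ) ⊗ₖ Matrix.single a (f a) (1 : ℂ))

/-- The ideal state `ρ_R ⊗ I_Z / |Z|`. -/
def idealState {R : Type*} (Z : Type*) [Fintype Z] [DecidableEq Z] (ρR : Matrix R R ℂ) :
    Matrix (R × Z) (R × Z) ℂ :=
  ρR ⊗ₖ ((Fintype.card Z : ℂ)⁻¹ • (1 : Matrix Z Z ℂ))

/-- The size `⌊2^{nr}⌋` of the alphabet `Z_n = {1, …, 2^{nr}}`. -/
def hashSize (r : ℝ) (n : ℕ) : ℕ := ⌊(2 : ℝ) ^ ((n : ℝ) * r)⌋₊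

/-- The optimal performance of privacy amplification at rate `r` on `n` copies: the infimum over
all hash functions `f : Aⁿ → Z_n` of `P(Φ_f(ρ_{RA}^{⊗ n}), ρ_R^{⊗ n} ⊗ I / |Z_n|)`. -/
def optimalDistance {R A : Type*} [Fintype R] [Fintype A] [DecidableEq R] [DecidableEq A]
    (ρ : Matrix (R × A) (R × A) ℂ) (r : ℝ) (n : ℕ) : ℝ :=
  ⨅ f : (Fin n → A) → Fin (hashSize r n),
    purifiedDistance (hashChannel f (tensorPowBipartite n ρ))
      (idealState (Fin (hashSize r n)) (tensorPow n (reducedR ρ)))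

/-! ### Classical entropic quantities (logarithms to base two) -/

/-- The marginal `p(x) = ∑ₐ p(x,a)`. -/
def marginal {R A : Type*} [Fintype A] (p : R × A → ℝ) (x : R) : ℝ := ∑ a, p (x, a)

/-- The conditional distribution `p(·|x)`; only used where `p(x) > 0`. -/
def conditional {R A : Type*} [Fintype A] (p : R × A → ℝ) (x : R) (a : A) : ℝ :=
  p (x, a) / marginal p x

/-- The relative entropy `D(t‖p)`, equal to `+∞` unless `supp t ⊆ supp p`. -/
def relEntropy {R : Type*} [Fintype R] (t p : R → ℝ) : EReal :=
  open Classical in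
  if ∀ x, p x = 0 → t x = 0 then ((∑ x, t x * Real.logb 2 (t x / p x) : ℝ) : EReal) else ⊤

/-- The Rényi entropy `H_α(q) = (1-α)⁻¹ log ∑ q(a)^α` of order `α > 0`; for `α = 1` it is the
Shannon entropy. -/
def renyiEntropy {A : Type*} [Fintype A] (α : ℝ) (q : A → ℝ) : ℝ :=
  open Classical in
  if α = 1 then -∑ a, q a * Real.logb 2 (q a)
  else 1 / (1 - α) * Real.logb 2 (∑ a, q a ^ α)

/-- The value
`sup_{1/2 ≤ α ≤ 1} inf_t {2 D(t‖p) + ((1-α)/α) (r - 𝔼_{x∼t} H_α(p(·|x)))}`. -/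
def exponentFormula {R A : Type*} [Fintype R] [Fintype A] (p : R × A → ℝ) (r : ℝ) : EReal :=
  ⨆ α ∈ Set.Icc (1 / 2 : ℝ) 1, ⨅ t ∈ stdSimplex ℝ R,
    (2 * relEntropy t (marginal p) +
      (((1 - α) / α * (r - ∑ x, t x * renyiEntropy α (conditional p x)) : ℝ) : EReal))

end

end PrivacyAmplification

/-!
All states involved are diagonal, so the fidelity is the classical quantity
`F_f = ∑ₓ ∑_z √(P_f(x,z) P(x) / M)`, where `P` is the law on `Rⁿ Aⁿ`, `P_f` its image under
`id × f` and `M = |Z_n|` (`fidelity_hash`). As `F²/2 ≤ 1 - √(1 - F²) ≤ F²`, the claim is about the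
exponential rate of the largest `F_f²`. Put

  `J(α) = (1-α)/α · r - 2 log ∑ₓ p(x) (∑ₐ p(a|x)^α)^{1/(2α)}`   (`exponentAt`).

Gibbs' inequality identifies `J(α)` with the infimum over `t` in the claimed formula; the minimizer
is the tilted distribution `tiltR` (`iInf_objective_eq`).

*Converse.* For every `α ∈ [1/2, 1]`, subadditivity of `u ↦ u^α` on the fibres of `f` and the
power-mean inequality on `Z_n` bound `F_f` by an expression that factorizes over the `n` copies
(`hashFidelity_le`, `hashFidelity_prodWeight_le`). Hence the exponent is at least `J(α) - 1/n`
(`exponentAt_sub_le`).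

*Achievability.* Let `S` be a set of pairs on which the conditional probabilities are at most `ω`
and whose sections have conditional probability at most `K`. By a first and second moment estimate
that uses only the collision probability `1/M`, a uniformly random `f` satisfies
`𝔼 F_f ≥ P(S) / √(M ω + K)` (`exists_hashFidelity_ge`). This is applied to the words which are
typical for the tilted joint distribution, proportional on each fibre over `x` to `p(a|x)^α`
(`eventually_exists_hashFidelity_ge`). With `H` the conditional entropy of the tilted distribution,
the resulting exponent is `J(α) + max (r - H) 0 - (1-α)/α · (r - H)`. The last two terms cancel for
`α = 1` if `r ≤ H`, for `α = 1/2` if `r ≥ H`, and whenever `H = r`. Since `H` is continuous in `α`,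
the intermediate value theorem provides such an order (`exists_order`). At this order the two bounds
meet, so it also attains the supremum of `J`, and no minimax theorem is needed.
-/

namespace PrivacyAmplification

noncomputable section

/-! ### Fidelity of classical states -/

lemma sqrt_diagonal {ι : Type*} [Fintype ι] [DecidableEq ι] {d : ι → ℝ} (hd : ∀ i, 0 ≤ d i) :
    CFC.sqrt (Matrix.diagonal fun i => (d i : ℂ)) =
      Matrix.diagonal fun i => ((Real.sqrt (d i) : ℝ) : ℂ) := by
  have hs : (0 : Matrix ι ι ℂ) ≤ Matrix.diagonal fun i => ((Real.sqrt (d i) : ℝ) : ℂ) := by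
    rw [Matrix.nonneg_iff_posSemidef, Matrix.posSemidef_diagonal_iff]
    intro i
    exact_mod_cast Real.sqrt_nonneg _
  refine CFC.sqrt_unique ?_ hs
  rw [Matrix.diagonal_mul_diagonal]
  congr 1
  ext i
  rw [← Complex.ofReal_mul, Real.mul_self_sqrt (hd i)]

/-- For commuting, hence simultaneously diagonal, states the fidelity is the Bhattacharyya
coefficient. -/
lemma fidelity_diagonal {ι : Type*} [Fintype ι] [DecidableEq ι] {d e : ι → ℝ}
    (hd : ∀ i, 0 ≤ d i) (he : ∀ i, 0 ≤ e i) :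
    fidelity (Matrix.diagonal fun i => (d i : ℂ)) (Matrix.diagonal fun i => (e i : ℂ)) =
      ∑ i, Real.sqrt (d i * e i) := by
  have key : (Matrix.diagonal (fun i => ((Real.sqrt (d i) : ℝ) : ℂ)) *
      Matrix.diagonal fun i => ((Real.sqrt (e i) : ℝ) : ℂ)) =
      Matrix.diagonal fun i => ((Real.sqrt (d i * e i) : ℝ) : ℂ) := by
    rw [Matrix.diagonal_mul_diagonal]
    congr 1
    ext i
    rw [Real.sqrt_mul (hd i), Complex.ofReal_mul]
  have key2 : (Matrix.diagonal fun i => ((Real.sqrt (d i * e i) : ℝ) : ℂ)).conjTranspose *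
      (Matrix.diagonal fun i => ((Real.sqrt (d i * e i) : ℝ) : ℂ)) =
      Matrix.diagonal fun i => ((d i * e i : ℝ) : ℂ) := by
    rw [Matrix.diagonal_conjTranspose, Matrix.diagonal_mul_diagonal]
    congr 1
    ext i
    simp only [Pi.star_apply, RCLike.star_def, Complex.conj_ofReal]
    rw [← Complex.ofReal_mul, Real.mul_self_sqrt (mul_nonneg (hd i) (he i))]
  rw [fidelity, traceNorm, sqrt_diagonal hd, sqrt_diagonal he, key, key2,
    sqrt_diagonal fun i => mul_nonneg (hd i) (he i), Matrix.trace_diagonal]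
  rw [← Complex.ofReal_sum, Complex.ofReal_re]

lemma hashChannel_diagonal {X B Z : Type*} [Fintype X] [Fintype B] [DecidableEq X] [DecidableEq B]
    [DecidableEq Z] (f : B → Z) (d : X × B → ℝ) :
    hashChannel f (Matrix.diagonal fun y => (d y : ℂ)) =
      Matrix.diagonal fun y : X × Z => ((∑ b, if f b = y.2 then d (y.1, b) else 0 : ℝ) : ℂ) := by
  ext ⟨x, z⟩ ⟨x', z'⟩
  simp only [hashChannel, Matrix.sum_apply]
  have h : ∀ b, (((1 : Matrix X X ℂ) ⊗ₖ Matrix.single (f b) b (1 : ℂ)) *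
      (Matrix.diagonal fun y => (d y : ℂ)) *
      ((1 : Matrix X X ℂ) ⊗ₖ Matrix.single b (f b) (1 : ℂ))) (x, z) (x', z') =
      if (x, z) = (x', z') then (if f b = z then (d (x, b) : ℂ) else 0) else 0 := by
    intro b
    rw [Matrix.mul_apply, Fintype.sum_prod_type]
    simp only [Matrix.mul_diagonal, Matrix.kroneckerMap_apply, Matrix.one_apply,
      Matrix.single_apply]
    rw [Finset.sum_eq_single x, Finset.sum_eq_single b]
    · simp only [Prod.mk.injEq]
      rcases eq_or_ne x x' with rfl | hx
      · rcases eq_or_ne z z' with rfl | hz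
        · by_cases hz : f b = z <;> simp [hz]
        · by_cases hz' : f b = z
          · simp [hz', hz]
          · simp [hz', hz]
      · simp [hx]
    · intro b' _ hb'
      simp [hb'.symm]
    · simp
    · intro x'' _ hx''
      simp [hx''.symm]
    · simp
  rw [Finset.sum_congr rfl fun b _ => h b, Matrix.diagonal_apply]
  split_ifs with hxz
  · push_cast
    exact Finset.sum_congr rfl fun b _ => by split_ifs <;> simp
  · simp

/-- The `n`-fold product of the weights `p`, on pairs of words. -/
def prodWeight {R A : Type*} (n : ℕ) (p : R × A → ℝ) (y : (Fin n → R) × (Fin n → A)) : ℝ :=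
  ∏ i, p (y.1 i, y.2 i)

lemma tensorPowBipartite_classicalState {R A : Type*} [DecidableEq R] [DecidableEq A]
    (n : ℕ) (p : R × A → ℝ) :
    tensorPowBipartite n (classicalState p) =
      Matrix.diagonal fun y => (prodWeight n p y : ℂ) := by
  ext u v
  simp only [tensorPowBipartite, tensorPow, classicalState, Matrix.submatrix_apply, Matrix.of_apply,
    Matrix.diagonal_apply, prodWeight]
  split_ifs with h
  · subst h
    simp
  · have : ∃ i, (u.1 i, u.2 i) ≠ (v.1 i, v.2 i) := by
      by_contra! hc
      exact h (Prod.ext (funext fun i => (Prod.ext_iff.1 (hc i)).1)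
        (funext fun i => (Prod.ext_iff.1 (hc i)).2))
    obtain ⟨i, hi⟩ := this
    exact Finset.prod_eq_zero (Finset.mem_univ i) (if_neg hi)

lemma reducedR_classicalState {R A : Type*} [Fintype A] [DecidableEq R] [DecidableEq A]
    (p : R × A → ℝ) :
    reducedR (classicalState p) = Matrix.diagonal fun x => (marginal p x : ℂ) := by
  ext x x'
  simp only [reducedR, classicalState, Matrix.of_apply, Matrix.diagonal_apply, marginal]
  split_ifs with h
  · subst h
    simp
  · exact Finset.sum_eq_zero fun a _ => if_neg (by simp [h])

lemma marginal_prodWeight {R A : Type*} [Fintype A] (n : ℕ) (p : R × A → ℝ)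
    (x : Fin n → R) : marginal (prodWeight n p) x = ∏ i, marginal p (x i) := by
  classical
  simp only [marginal, prodWeight]
  rw [Finset.prod_univ_sum, Fintype.piFinset_univ]

lemma tensorPow_reducedR {R A : Type*} [Fintype A] [DecidableEq R] [DecidableEq A]
    (n : ℕ) (p : R × A → ℝ) :
    tensorPow n (reducedR (classicalState p)) =
      Matrix.diagonal fun x => (marginal (prodWeight n p) x : ℂ) := by
  rw [reducedR_classicalState]
  ext u v
  simp only [tensorPow, Matrix.of_apply, Matrix.diagonal_apply, marginal_prodWeight]
  split_ifs with h
  · subst h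
    simp
  · obtain ⟨i, hi⟩ := Function.ne_iff.1 h
    exact Finset.prod_eq_zero (Finset.mem_univ i) (if_neg hi)

lemma idealState_diagonal {X Z : Type*} [DecidableEq X] [Fintype Z] [DecidableEq Z] (d : X → ℝ) :
    idealState Z (Matrix.diagonal fun x => (d x : ℂ)) =
      Matrix.diagonal fun y : X × Z => ((d y.1 / Fintype.card Z : ℝ) : ℂ) := by
  ext ⟨x, z⟩ ⟨x', z'⟩
  simp only [idealState, Matrix.kroneckerMap_apply, Matrix.diagonal_apply, Matrix.smul_apply,
    Matrix.one_apply, Prod.mk.injEq]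
  by_cases hx : x = x' <;> by_cases hz : z = z' <;> simp [hx, hz, div_eq_mul_inv]

/-- The fidelity between the hashed weights `π ∘ (id × f)⁻¹` and the product of the first marginal
of `π` with the uniform distribution on `Z`. -/
def hashFidelity {X B Z : Type*} [Fintype X] [Fintype B] [Fintype Z] [DecidableEq Z]
    (π : X × B → ℝ) (f : B → Z) : ℝ :=
  ∑ x, ∑ z, Real.sqrt ((∑ b, if f b = z then π (x, b) else 0) *
    (marginal π x / Fintype.card Z))

lemma fidelity_hash {R A : Type*} [Fintype R] [Fintype A] [DecidableEq R] [DecidableEq A]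
    {p : R × A → ℝ} (hp : ∀ y, 0 ≤ p y) (n : ℕ) {Z : Type*} [Fintype Z] [DecidableEq Z]
    (f : (Fin n → A) → Z) :
    fidelity (hashChannel f (tensorPowBipartite n (classicalState p)))
      (idealState Z (tensorPow n (reducedR (classicalState p)))) =
      hashFidelity (prodWeight n p) f := by
  have hπ : ∀ y, 0 ≤ prodWeight n p y := fun y => Finset.prod_nonneg fun i _ => hp _
  rw [tensorPowBipartite_classicalState, tensorPow_reducedR, hashChannel_diagonal,
    idealState_diagonal, fidelity_diagonal, Fintype.sum_prod_type]
  · rfl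
  · exact fun y => Finset.sum_nonneg fun b _ => by split_ifs <;> simp [hπ]
  · exact fun y => div_nonneg (Finset.sum_nonneg fun b _ => hπ _) (Nat.cast_nonneg _)

/-! ### One-shot bounds for hash functions -/

lemma rpow_sum_le_sum_rpow {ι : Type*} (s : Finset ι) {g : ι → ℝ} (hg : ∀ i, 0 ≤ g i) {α : ℝ}
    (h0 : 0 < α) (h1 : α ≤ 1) : (∑ i ∈ s, g i) ^ α ≤ ∑ i ∈ s, g i ^ α := by
  classical
  induction s using Finset.induction_on with
  | empty => simp [Real.zero_rpow h0.ne']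
  | insert i s hi ih =>
    rw [Finset.sum_insert hi, Finset.sum_insert hi]
    exact (Real.rpow_add_le_add_rpow (hg i) (Finset.sum_nonneg fun i _ => hg i) h0.le h1).trans
      (by gcongr)

section OneShot

variable {X B Z : Type*} [Fintype X] [Fintype B] [Fintype Z] [DecidableEq Z]

/-- Grouping by the value of `f` does not change the total weight. -/
lemma sum_fiber (f : B → Z) (g : B → ℝ) : ∑ z, ∑ b, (if f b = z then g b else 0) = ∑ b, g b := by
  rw [Finset.sum_comm]
  simp

/-- The one-shot converse bound. It combines `(∑ᵢ gᵢ)^α ≤ ∑ᵢ gᵢ^α` on the fibres of `f` with the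
power-mean inequality of exponent `2α ≥ 1` on `Z`. -/
lemma hashFidelity_le [Nonempty Z] {π : X × B → ℝ} (hπ : ∀ y, 0 ≤ π y) (f : B → Z) {α : ℝ}
    (hα : α ∈ Set.Icc (1 / 2 : ℝ) 1) :
    hashFidelity π f ≤ (Fintype.card Z : ℝ) ^ ((α - 1) / (2 * α)) *
      ∑ x, Real.sqrt (marginal π x) * (∑ b, π (x, b) ^ α) ^ (1 / (2 * α)) := by
  obtain ⟨hα2, hα1⟩ := hα
  have hα0 : 0 < α := by linarith
  have hM : (0 : ℝ) < Fintype.card Z := by exact_mod_cast Fintype.card_pos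
  rw [hashFidelity, Finset.mul_sum]
  refine Finset.sum_le_sum fun x _ => ?_
  set P : Z → ℝ := fun z => ∑ b, if f b = z then π (x, b) else 0 with hP
  have hPn : ∀ z, 0 ≤ P z := fun z => Finset.sum_nonneg fun b _ => by split_ifs <;> simp [hπ]
  have h1 : ∑ z, P z ^ α ≤ ∑ b, π (x, b) ^ α := by
    calc ∑ z, P z ^ α ≤ ∑ z, ∑ b, (if f b = z then π (x, b) else 0) ^ α :=
          Finset.sum_le_sum fun z _ => rpow_sum_le_sum_rpow _
            (fun b => by split_ifs <;> simp [hπ]) hα0 hα1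
      _ = ∑ z, ∑ b, (if f b = z then π (x, b) ^ α else 0) := by
          refine Finset.sum_congr rfl fun z _ => Finset.sum_congr rfl fun b _ => ?_
          split_ifs <;> simp [Real.zero_rpow hα0.ne']
      _ = _ := sum_fiber f _
  have h2 : (∑ z, Real.sqrt (P z)) ^ (2 * α) ≤
      (Fintype.card Z : ℝ) ^ (2 * α - 1) * ∑ z, P z ^ α := by
    have := Real.rpow_sum_le_const_mul_sum_rpow_of_nonneg (s := (Finset.univ : Finset Z))
      (f := fun z => Real.sqrt (P z)) (p := 2 * α) (by linarith) (fun z _ => Real.sqrt_nonneg _)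
    refine this.trans (le_of_eq ?_)
    rw [Finset.card_univ]
    congr 1
    refine Finset.sum_congr rfl fun z _ => ?_
    rw [Real.sqrt_eq_rpow, ← Real.rpow_mul (hPn z)]
    congr 1
    ring
  have h3 : ∑ z, Real.sqrt (P z) ≤ (Fintype.card Z : ℝ) ^ ((2 * α - 1) / (2 * α)) *
      (∑ b, π (x, b) ^ α) ^ (1 / (2 * α)) := by
    have hs : 0 ≤ ∑ z, Real.sqrt (P z) := Finset.sum_nonneg fun z _ => Real.sqrt_nonneg _
    have hA : 0 ≤ ∑ b, π (x, b) ^ α := Finset.sum_nonneg fun b _ => Real.rpow_nonneg (hπ _) _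
    calc ∑ z, Real.sqrt (P z) = ((∑ z, Real.sqrt (P z)) ^ (2 * α)) ^ (1 / (2 * α)) := by
          rw [← Real.rpow_mul hs, mul_one_div_cancel (by positivity), Real.rpow_one]
      _ ≤ ((Fintype.card Z : ℝ) ^ (2 * α - 1) * ∑ b, π (x, b) ^ α) ^ (1 / (2 * α)) := by
          refine Real.rpow_le_rpow (Real.rpow_nonneg hs _) (h2.trans ?_) (by positivity)
          gcongr
      _ = _ := by
          rw [Real.mul_rpow (by positivity) hA, ← Real.rpow_mul hM.le]
          congr 2
          ring
  have hm : 0 ≤ marginal π x := Finset.sum_nonneg fun b _ => hπ _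
  calc ∑ z, Real.sqrt (P z * (marginal π x / Fintype.card Z))
      = Real.sqrt (marginal π x) * ((Fintype.card Z : ℝ) ^ (-(1 / 2) : ℝ) *
          ∑ z, Real.sqrt (P z)) := by
        rw [Finset.mul_sum, Finset.mul_sum]
        refine Finset.sum_congr rfl fun z _ => ?_
        rw [Real.sqrt_mul (hPn z), Real.sqrt_div hm, Real.rpow_neg hM.le, ← Real.sqrt_eq_rpow]
        ring
    _ ≤ Real.sqrt (marginal π x) * ((Fintype.card Z : ℝ) ^ (-(1 / 2) : ℝ) *
          ((Fintype.card Z : ℝ) ^ ((2 * α - 1) / (2 * α)) *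
            (∑ b, π (x, b) ^ α) ^ (1 / (2 * α)))) := by gcongr
    _ = _ := by
        rw [← mul_assoc ((Fintype.card Z : ℝ) ^ _), ← Real.rpow_add hM,
          show -(1 / 2) + (2 * α - 1) / (2 * α) = (α - 1) / (2 * α) by field_simp; ring]
        ring

lemma hashFidelity_nonneg (π : X × B → ℝ) (f : B → Z) : 0 ≤ hashFidelity π f :=
  Finset.sum_nonneg fun _ _ => Finset.sum_nonneg fun _ _ => Real.sqrt_nonneg _

lemma hashFidelity_le_one [Nonempty Z] {π : X × B → ℝ} (hπ : ∀ y, 0 ≤ π y) (h1 : ∑ y, π y = 1)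
    (f : B → Z) : hashFidelity π f ≤ 1 := by
  refine (hashFidelity_le hπ f (α := 1) (by norm_num)).trans (le_of_eq ?_)
  have : ∀ x, Real.sqrt (marginal π x) * (∑ b, π (x, b) ^ (1 : ℝ)) ^ (1 / (2 * 1) : ℝ) =
      ∑ b, π (x, b) := by
    intro x
    have hm : 0 ≤ marginal π x := Finset.sum_nonneg fun b _ => hπ _
    simp only [Real.rpow_one]
    rw [mul_one, ← Real.sqrt_eq_rpow]
    exact Real.mul_self_sqrt hm
  simp only [this]
  rw [← Fintype.sum_prod_type, h1]
  simp

/-- A uniformly random function `B → Z` collides on two given points with probability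
`1 / |Z|`. -/
lemma card_mul_sum_collision [DecidableEq B] {b b' : B} (h : b' ≠ b) :
    (Fintype.card Z : ℝ) * ∑ f : B → Z, (if f b' = f b then (1 : ℝ) else 0) =
      Fintype.card (B → Z) := by
  have h1 : ∑ f : B → Z, (if f b' = f b then (1 : ℝ) else 0) =
      Fintype.card ({j // j ≠ b} → Z) := by
    rw [← (Equiv.funSplitAt b Z).symm.sum_comp, Fintype.sum_prod_type, Finset.sum_comm]
    simp [Equiv.funSplitAt, Equiv.piSplitAt, h]
  rw [h1, Fintype.card_congr (Equiv.funSplitAt b Z), Fintype.card_prod]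
  push_cast
  ring

/-- The tangent-type bound `√X ≥ X (3 - X/k) / (2 √k)`, with equality at `X = k`. -/
lemma mul_three_sub_le_sqrt {X k : ℝ} (hX : 0 ≤ X) (hk : 0 < k) :
    X * (3 - X / k) / (2 * Real.sqrt k) ≤ Real.sqrt X := by
  obtain ⟨u, hu, rfl⟩ : ∃ u, 0 ≤ u ∧ X = u ^ 2 := ⟨_, Real.sqrt_nonneg X, (Real.sq_sqrt hX).symm⟩
  obtain ⟨v, hv, rfl⟩ : ∃ v, 0 < v ∧ k = v ^ 2 :=
    ⟨_, Real.sqrt_pos.2 hk, (Real.sq_sqrt hk.le).symm⟩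
  rw [Real.sqrt_sq hu, Real.sqrt_sq hv.le, div_le_iff₀ (by positivity)]
  have : u ^ 2 * (3 - u ^ 2 / v ^ 2) * v ^ 2 ≤ u * (2 * v) * v ^ 2 := by
    have e : u ^ 2 * (3 - u ^ 2 / v ^ 2) * v ^ 2 = u ^ 2 * (3 * v ^ 2 - u ^ 2) := by
      field_simp
    rw [e]
    have := mul_nonneg hu (mul_nonneg (sq_nonneg (u - v)) (by linarith : 0 ≤ u + 2 * v))
    nlinarith
  exact le_of_mul_le_mul_right this (by positivity)

/-- The average over all hash functions of `∑_z √(v (f⁻¹ z))`, bounded below through first and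
second moments. -/
lemma sum_sum_sqrt_fiber_ge [Nonempty Z] {v : B → ℝ} {ω K : ℝ} (hv : ∀ b, 0 ≤ v b)
    (hω : ∀ b, v b ≤ ω) (hK : ∑ b, v b ≤ K) (hpos : 0 < ω + K / Fintype.card Z) [DecidableEq B] :
    (Fintype.card (B → Z) : ℝ) * ((∑ b, v b) / Real.sqrt (ω + K / Fintype.card Z)) ≤
      ∑ f : B → Z, ∑ z, Real.sqrt (∑ b, if f b = z then v b else 0) := by
  set k := ω + K / Fintype.card Z with hk
  set W := ∑ b, v b with hW
  have hM : (0 : ℝ) < Fintype.card Z := by exact_mod_cast Fintype.card_pos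
  have hW0 : 0 ≤ W := Finset.sum_nonneg fun b _ => hv b
  have hsq : ∀ f : B → Z, ∑ z, (∑ b, if f b = z then v b else 0) ^ 2 =
      ∑ b, ∑ b', v b * (v b' * if f b' = f b then 1 else 0) := by
    intro f
    simp only [sq, Finset.sum_mul_sum]
    rw [Finset.sum_comm]
    refine Finset.sum_congr rfl fun b _ => ?_
    rw [Finset.sum_comm]
    refine Finset.sum_congr rfl fun b' _ => ?_
    rw [Finset.sum_eq_single (f b)]
    · split_ifs <;> simp_all
    · intro z _ hz
      rw [if_neg hz.symm, zero_mul]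
    · simp
  have hcol : ∀ b b', ∑ f : B → Z, (if f b' = f b then (1 : ℝ) else 0) ≤
      Fintype.card (B → Z) * ((if b' = b then 1 else 0) + 1 / Fintype.card Z) := by
    intro b b'
    by_cases h : b' = b
    · subst h
      simp only [if_true, Finset.sum_const, Finset.card_univ, nsmul_eq_mul]
      gcongr
      linarith [one_div_pos.2 hM]
    · rw [← card_mul_sum_collision (Z := Z) h, if_neg h]
      field_simp
      simp
  -- The diagonal terms contribute `∑ v b ^ 2 ≤ ω W`, the others `W ^ 2 / |Z| ≤ K W / |Z|`.
  have hsecond : ∑ f : B → Z, ∑ z, (∑ b, if f b = z then v b else 0) ^ 2 ≤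
      Fintype.card (B → Z) * (W * k) := by
    calc ∑ f : B → Z, ∑ z, (∑ b, if f b = z then v b else 0) ^ 2
        = ∑ b, ∑ b', v b * (v b' * ∑ f : B → Z, if f b' = f b then 1 else 0) := by
          simp only [hsq]
          rw [Finset.sum_comm]
          refine Finset.sum_congr rfl fun b _ => ?_
          rw [Finset.sum_comm]
          refine Finset.sum_congr rfl fun b' _ => ?_
          rw [Finset.mul_sum, Finset.mul_sum]
      _ ≤ ∑ b, ∑ b', v b * (v b' *
            (Fintype.card (B → Z) * ((if b' = b then 1 else 0) + 1 / Fintype.card Z))) :=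
          Finset.sum_le_sum fun b _ => Finset.sum_le_sum fun b' _ =>
            mul_le_mul_of_nonneg_left (mul_le_mul_of_nonneg_left (hcol b b') (hv b')) (hv b)
      _ = ∑ b, v b * (Fintype.card (B → Z) * (v b + W / Fintype.card Z)) := by
          refine Finset.sum_congr rfl fun b _ => ?_
          rw [← Finset.mul_sum]
          congr 1
          have : ∀ b', v b' * ((Fintype.card (B → Z) : ℝ) *
              ((if b' = b then 1 else 0) + 1 / Fintype.card Z)) =
              Fintype.card (B → Z) * ((if b' = b then v b' else 0) +
                v b' * (1 / Fintype.card Z)) := by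
            intro b'
            split_ifs <;> ring
          simp only [this]
          rw [← Finset.mul_sum, Finset.sum_add_distrib, ← Finset.sum_mul]
          simp [hW, div_eq_mul_inv]
      _ ≤ ∑ b, v b * (Fintype.card (B → Z) * k) := by
          refine Finset.sum_le_sum fun b _ => mul_le_mul_of_nonneg_left ?_ (hv b)
          rw [hk]
          gcongr
          exact hω b
      _ = _ := by rw [← Finset.sum_mul]; ring
  have hsk : 0 < Real.sqrt k := Real.sqrt_pos.2 hpos
  calc (Fintype.card (B → Z) : ℝ) * (W / Real.sqrt k)
      = (3 * (Fintype.card (B → Z) * W) - Fintype.card (B → Z) * (W * k) / k) /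
          (2 * Real.sqrt k) := by
        field_simp
        ring
    _ ≤ (3 * (Fintype.card (B → Z) * W) -
          (∑ f : B → Z, ∑ z, (∑ b, if f b = z then v b else 0) ^ 2) / k) /
          (2 * Real.sqrt k) := by gcongr
    _ = ∑ f : B → Z, ∑ z, (∑ b, if f b = z then v b else 0) *
          (3 - (∑ b, if f b = z then v b else 0) / k) / (2 * Real.sqrt k) := by
        have : ∀ f : B → Z, ∑ z, (∑ b, if f b = z then v b else 0) *
          (3 - (∑ b, if f b = z then v b else 0) / k) / (2 * Real.sqrt k) =
            (3 * W - (∑ z, (∑ b, if f b = z then v b else 0) ^ 2) / k) / (2 * Real.sqrt k) := by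
          intro f
          rw [hW, ← sum_fiber f v, Finset.mul_sum, Finset.sum_div _ _ k,
            ← Finset.sum_sub_distrib, Finset.sum_div]
          exact Finset.sum_congr rfl fun z _ => by ring
        simp only [this]
        rw [← Finset.sum_div, Finset.sum_sub_distrib, ← Finset.sum_div]
        simp only [Finset.sum_const, Finset.card_univ, nsmul_eq_mul]
        ring
    _ ≤ _ := by
        refine Finset.sum_le_sum fun f _ => Finset.sum_le_sum fun z _ =>
          mul_three_sub_le_sqrt (Finset.sum_nonneg fun b _ => ?_) hpos
        split_ifs <;> simp [hv]

/-- The one-shot achievability bound: if the conditional weights of `π` on the set `S` are at most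
`ω`, and add up to at most `K` for each `x`, then some hash function does at least as well as the
average one. -/
lemma exists_hashFidelity_ge [Nonempty Z] {π : X × B → ℝ} (hπ : ∀ y, 0 ≤ π y)
    (S : Finset (X × B)) {ω K : ℝ} (hω0 : 0 < ω) (hK0 : 0 < K)
    (hω : ∀ y ∈ S, π y ≤ ω * marginal π y.1)
    (hK : ∀ x, (∑ b, (S : Set (X × B)).indicator π (x, b)) ≤ K * marginal π x) :
    ∃ f : B → Z, (∑ y ∈ S, π y) / Real.sqrt (Fintype.card Z * ω + K) ≤ hashFidelity π f := by
  classical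
  have hM : (0 : ℝ) < Fintype.card Z := by exact_mod_cast Fintype.card_pos
  set M : ℝ := (Fintype.card Z : ℝ)
  set v : X × B → ℝ := (S : Set (X × B)).indicator π with hv
  have hv0 : ∀ y, 0 ≤ v y := fun y => Set.indicator_nonneg (fun y _ => hπ y) y
  have hvle : ∀ y, v y ≤ π y := fun y => Set.indicator_le_self' (fun y _ => hπ y) y
  have hSv : ∑ y ∈ S, π y = ∑ x, ∑ b, v (x, b) := by
    rw [← Fintype.sum_prod_type', hv, Finset.sum_indicator_eq_sum_filter]
    simp
  have hx : ∀ x, (Fintype.card (B → Z) : ℝ) * ((∑ b, v (x, b)) / Real.sqrt (M * ω + K)) ≤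
      ∑ f : B → Z, ∑ z, Real.sqrt ((∑ b, if f b = z then π (x, b) else 0) *
        (marginal π x / M)) := by
    intro x
    have hm0 : 0 ≤ marginal π x := Finset.sum_nonneg fun b _ => hπ _
    rcases hm0.eq_or_lt with hm | hm
    · have : ∑ b, v (x, b) = 0 := by
        refine le_antisymm ?_ (Finset.sum_nonneg fun b _ => hv0 _)
        rw [hm]
        exact Finset.sum_le_sum fun b _ => hvle _
      rw [this, zero_div, mul_zero]
      exact Finset.sum_nonneg fun f _ => Finset.sum_nonneg fun z _ => Real.sqrt_nonneg _
    · have h1 := sum_sum_sqrt_fiber_ge (Z := Z) (v := fun b => v (x, b))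
        (ω := ω * marginal π x) (K := K * marginal π x) (fun b => hv0 _) (fun b => ?_) (hK x)
        (by positivity)
      · have e : ω * marginal π x + K * marginal π x / M =
            (M * ω + K) * (marginal π x / M) := by
          field_simp
        rw [e, Real.sqrt_mul (by positivity)] at h1
        have hs : 0 < Real.sqrt (marginal π x / M) := Real.sqrt_pos.2 (by positivity)
        calc _ = ((Fintype.card (B → Z) : ℝ) * ((∑ b, v (x, b)) / (Real.sqrt (M * ω + K) *
                Real.sqrt (marginal π x / M)))) * Real.sqrt (marginal π x / M) := by
              field_simp
          _ ≤ (∑ f : B → Z, ∑ z, Real.sqrt (∑ b, if f b = z then v (x, b) else 0)) *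
                Real.sqrt (marginal π x / M) := by gcongr
          _ ≤ _ := by
              rw [Finset.sum_mul]
              refine Finset.sum_le_sum fun f _ => ?_
              rw [Finset.sum_mul]
              refine Finset.sum_le_sum fun z _ => ?_
              rw [← Real.sqrt_mul' _ (by positivity)]
              refine Real.sqrt_le_sqrt (mul_le_mul_of_nonneg_right ?_ (by positivity))
              refine Finset.sum_le_sum fun b _ => ?_
              split_ifs
              · exact hvle _
              · exact le_rfl
      · by_cases hb : (x, b) ∈ S
        · rw [hv, Set.indicator_of_mem (by exact_mod_cast hb)]
          exact hω _ hb
        · rw [hv, Set.indicator_of_notMem (by exact_mod_cast hb)]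
          positivity
  obtain ⟨f, -, hf⟩ := Finset.exists_le_of_sum_le (s := (Finset.univ : Finset (B → Z)))
    (f := fun _ => (∑ y ∈ S, π y) / Real.sqrt (M * ω + K)) (g := fun f => hashFidelity π f)
    Finset.univ_nonempty (by
      simp only [hashFidelity]
      rw [Finset.sum_comm, Finset.sum_const, Finset.card_univ, nsmul_eq_mul, hSv, Finset.sum_div,
        Finset.mul_sum]
      exact Finset.sum_le_sum fun x _ => hx x)
  exact ⟨f, hf⟩

end OneShot

/-! ### Typical words and the achievable exponent -/

section Typicality

variable {Y : Type*} [Fintype Y]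

lemma sum_fin_succ_fun {n : ℕ} (F : (Fin (n + 1) → Y) → ℝ) :
    ∑ w, F w = ∑ y, ∑ w : Fin n → Y, F (Fin.cons y w) := by
  rw [← Fintype.sum_prod_type']
  exact ((Fin.consEquiv fun _ => Y).sum_comp F).symm

lemma sum_prod_mul_sum_eq_zero {Q g : Y → ℝ} (hg : ∑ y, Q y * g y = 0)
    (n : ℕ) : ∑ w : Fin n → Y, (∏ i, Q (w i)) * ∑ i, g (w i) = 0 := by
  induction n with
  | zero => simp
  | succ n ih =>
    rw [sum_fin_succ_fun]
    simp only [Fin.prod_univ_succ, Fin.sum_univ_succ, Fin.cons_zero, Fin.cons_succ]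
    have : ∀ y, ∑ w : Fin n → Y, Q y * (∏ i, Q (w i)) * (g y + ∑ i, g (w i)) =
        Q y * g y * (∑ w : Fin n → Y, ∏ i, Q (w i)) +
          Q y * ∑ w : Fin n → Y, (∏ i, Q (w i)) * ∑ i, g (w i) := by
      intro y
      rw [Finset.mul_sum, Finset.mul_sum, ← Finset.sum_add_distrib]
      exact Finset.sum_congr rfl fun w _ => by ring
    simp only [this, ih, mul_zero, add_zero]
    rw [← Finset.sum_mul, hg, zero_mul]

/-- The variance of a sum of `n` independent centred variables with the same law `Q`. -/
lemma sum_prod_mul_sum_sq {Q g : Y → ℝ} (hQ : ∑ y, Q y = 1) (hg : ∑ y, Q y * g y = 0)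
    (n : ℕ) : ∑ w : Fin n → Y, (∏ i, Q (w i)) * (∑ i, g (w i)) ^ 2 =
      n * ∑ y, Q y * g y ^ 2 := by
  induction n with
  | zero => simp
  | succ n ih =>
    rw [sum_fin_succ_fun]
    simp only [Fin.prod_univ_succ, Fin.sum_univ_succ, Fin.cons_zero, Fin.cons_succ]
    have : ∀ y, ∑ w : Fin n → Y, Q y * (∏ i, Q (w i)) * (g y + ∑ i, g (w i)) ^ 2 =
        Q y * g y ^ 2 * (∑ w : Fin n → Y, ∏ i, Q (w i)) +
          2 * (Q y * g y) * (∑ w : Fin n → Y, (∏ i, Q (w i)) * ∑ i, g (w i)) +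
          Q y * ∑ w : Fin n → Y, (∏ i, Q (w i)) * (∑ i, g (w i)) ^ 2 := by
      intro y
      rw [Finset.mul_sum, Finset.mul_sum, Finset.mul_sum, ← Finset.sum_add_distrib,
        ← Finset.sum_add_distrib]
      exact Finset.sum_congr rfl fun w _ => by ring
    simp only [this, ih, sum_prod_mul_sum_eq_zero hg, mul_zero, add_zero]
    rw [Finset.sum_add_distrib, ← Finset.sum_mul, ← Finset.sum_mul, hQ, ← Fintype.sum_pow, hQ]
    push_cast
    ring

/-- The words all of whose letters have positive `Q`-probability and along which the empirical mean
of each `g j` is within `δ` of its `Q`-mean. -/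
def IsTypical {ι : Type*} (Q : Y → ℝ) (g : ι → Y → ℝ) (δ : ℝ) {n : ℕ} (w : Fin n → Y) : Prop :=
  (∀ i, 0 < Q (w i)) ∧ ∀ j, |∑ i, g j (w i) - n * ∑ y, Q y * g j y| ≤ n * δ

open Classical in
/-- The weak law of large numbers: by Chebyshev's inequality, typical words have probability at
least one half once `n` is large. -/
lemma eventually_half_le_sum_typical {ι : Type*} [Fintype ι] {Q : Y → ℝ} (hQ0 : ∀ y, 0 ≤ Q y)
    (hQ : ∑ y, Q y = 1) (g : ι → Y → ℝ) {δ : ℝ} (hδ : 0 < δ) :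
    ∀ᶠ n : ℕ in atTop, 1 / 2 ≤
      ∑ w ∈ Finset.univ.filter (fun w : Fin n → Y => IsTypical Q g δ w), ∏ i, Q (w i) := by
  set μ : ι → ℝ := fun j => ∑ y, Q y * g j y with hμ
  set C : ℝ := ∑ j, ∑ y, Q y * (g j y - μ j) ^ 2 with hC
  filter_upwards [eventually_gt_atTop 0, eventually_ge_atTop ⌈2 * C / δ ^ 2⌉₊] with n hn hnC
  have hn0 : (0 : ℝ) < n := by exact_mod_cast hn
  have hnC' : 2 * C / δ ^ 2 ≤ n := (Nat.le_ceil _).trans (by exact_mod_cast hnC)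
  have hcent : ∀ j, ∑ y, Q y * (g j y - μ j) = 0 := by
    intro j
    simp only [mul_sub, Finset.sum_sub_distrib]
    rw [← Finset.sum_mul, hQ, one_mul, hμ, sub_self]
  have hP0 : ∀ w : Fin n → Y, 0 ≤ ∏ i, Q (w i) := fun w => Finset.prod_nonneg fun i _ => hQ0 _
  have htot : ∑ w : Fin n → Y, ∏ i, Q (w i) = 1 := by
    rw [← Fintype.sum_pow, hQ, one_pow]
  have hsplit := Finset.sum_filter_add_sum_filter_not Finset.univ
    (fun w : Fin n → Y => IsTypical Q g δ w) (fun w => ∏ i, Q (w i))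
  have hbad : ∑ w ∈ Finset.univ.filter (fun w : Fin n → Y => ¬ IsTypical Q g δ w),
      ∏ i, Q (w i) ≤ 1 / 2 := by
    calc _ ≤ ∑ w ∈ Finset.univ.filter (fun w : Fin n → Y => ¬ IsTypical Q g δ w),
          (∏ i, Q (w i)) * ((∑ j, (∑ i, (g j (w i) - μ j)) ^ 2) / (n * δ) ^ 2) := by
          refine Finset.sum_le_sum fun w hw => ?_
          have hw := (Finset.mem_filter.1 hw).2
          by_cases hpos : ∀ i, 0 < Q (w i)
          · refine le_mul_of_one_le_right (hP0 w) ?_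
            obtain ⟨j, hj⟩ : ∃ j, n * δ < |∑ i, g j (w i) - n * μ j| := by
              by_contra! hc
              exact hw ⟨hpos, hc⟩
            rw [one_le_div (by positivity)]
            have e : ∑ i, (g j (w i) - μ j) = ∑ i, g j (w i) - n * μ j := by
              simp [Finset.sum_sub_distrib]
            calc (n * δ) ^ 2 ≤ |∑ i, g j (w i) - n * μ j| ^ 2 := by gcongr
              _ = (∑ i, (g j (w i) - μ j)) ^ 2 := by rw [sq_abs, e]
              _ ≤ _ := Finset.single_le_sum (f := fun j => (∑ i, (g j (w i) - μ j)) ^ 2)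
                  (fun j _ => sq_nonneg _) (Finset.mem_univ j)
          · push Not at hpos
            obtain ⟨i, hi⟩ := hpos
            rw [Finset.prod_eq_zero (Finset.mem_univ i) (le_antisymm hi (hQ0 _)), zero_mul]
      _ ≤ ∑ w : Fin n → Y,
          (∏ i, Q (w i)) * ((∑ j, (∑ i, (g j (w i) - μ j)) ^ 2) / (n * δ) ^ 2) :=
          Finset.sum_le_sum_of_subset_of_nonneg (Finset.filter_subset _ _) fun w _ _ =>
            mul_nonneg (hP0 w) (div_nonneg (Finset.sum_nonneg fun j _ => sq_nonneg _)
              (sq_nonneg _))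
      _ = (∑ j, ∑ w : Fin n → Y, (∏ i, Q (w i)) * (∑ i, (g j (w i) - μ j)) ^ 2) /
            (n * δ) ^ 2 := by
          rw [Finset.sum_comm, Finset.sum_div]
          refine Finset.sum_congr rfl fun w _ => ?_
          rw [← Finset.mul_sum, mul_div_assoc]
      _ = n * C / (n * δ) ^ 2 := by
          rw [hC, Finset.mul_sum]
          congr 1
          exact Finset.sum_congr rfl fun j _ =>
            sum_prod_mul_sum_sq (g := fun y => g j y - μ j) hQ (hcent j) n
      _ ≤ 1 / 2 := by
          rw [div_le_iff₀ (by positivity)] at hnC' ⊢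
          nlinarith
  linarith

end Typicality

lemma prod_eq_rpow_sum_logb {Y : Type*} {n : ℕ} {h : Y → ℝ} {w : Fin n → Y}
    (hw : ∀ i, 0 < h (w i)) :
    ∏ i, h (w i) = (2 : ℝ) ^ ∑ i, Real.logb 2 (h (w i)) := by
  rw [Real.rpow_sum_of_pos two_pos]
  exact Finset.prod_congr rfl fun i _ =>
    (Real.rpow_logb two_pos (by norm_num) (hw i)).symm

/-- Pairs of words are words of pairs. -/
lemma sum_word_pair {R A : Type*} [Fintype R] [Fintype A] {n : ℕ}
    (G : (Fin n → R × A) → ℝ) :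
    ∑ y : (Fin n → R) × (Fin n → A), G (fun i => (y.1 i, y.2 i)) = ∑ w, G w :=
  (Equiv.arrowProdEquivProdArrow (Fin n) (fun _ => R) (fun _ => A)).symm.sum_comp G

lemma marginal_nonneg {R A : Type*} [Fintype A] {p : R × A → ℝ} (hp : ∀ y, 0 ≤ p y) (x : R) :
    0 ≤ marginal p x := Finset.sum_nonneg fun _ _ => hp _

lemma le_marginal {R A : Type*} [Fintype A] {p : R × A → ℝ} (hp : ∀ y, 0 ≤ p y) (y : R × A) :
    p y ≤ marginal p y.1 :=
  Finset.single_le_sum (f := fun a => p (y.1, a)) (fun _ _ => hp _) (Finset.mem_univ y.2)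

lemma marginal_mul_conditional {R A : Type*} [Fintype A] {p : R × A → ℝ} (hp : ∀ y, 0 ≤ p y)
    (y : R × A) : marginal p y.1 * conditional p y.1 y.2 = p y := by
  rcases (marginal_nonneg hp y.1).eq_or_lt with h | h
  · have := le_marginal hp y
    rw [← h] at this
    rw [← h, zero_mul]
    exact le_antisymm (hp y) this
  · rw [conditional, mul_div_cancel₀ _ h.ne']

/-- Achievability through the typical words of a test distribution `Q = t · V` on `R × A`. The
exponents `a₁, a₂, a₃` are `D(Q‖p)`, `D(V‖p(·|·)|t)` and `D(V‖p(·|·)|t) + H(V|t)`. -/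
lemma eventually_exists_hashFidelity_ge {R A : Type*} [Fintype R] [Fintype A]
    {p : R × A → ℝ} (hp : ∀ y, 0 ≤ p y) {t : R → ℝ} {V : R × A → ℝ} (ht : ∀ x, 0 ≤ t x)
    (hV : ∀ y, 0 ≤ V y) (hV1 : ∀ x, ∑ a, V (x, a) ≤ 1) (hQ : ∑ y, t y.1 * V y = 1)
    (hsupp : ∀ y, 0 < t y.1 * V y → 0 < p y) {a₁ a₂ a₃ : ℝ}
    (h₁ : ∑ y, t y.1 * V y * Real.logb 2 (t y.1 * V y / p y) = a₁)
    (h₂ : ∑ y, t y.1 * V y * Real.logb 2 (V y / conditional p y.1 y.2) = a₂)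
    (h₃ : ∑ y, t y.1 * V y * Real.logb 2 (conditional p y.1 y.2) = -a₃)
    {δ : ℝ} (hδ : 0 < δ) :
    ∀ᶠ n : ℕ in atTop, ∀ (M : ℕ) [NeZero M], ∃ f : (Fin n → A) → Fin M,
      1 / 2 * (2 : ℝ) ^ (-(n * (a₁ + δ))) /
        Real.sqrt (M * (2 : ℝ) ^ (-(n * (a₃ - δ))) + (2 : ℝ) ^ (-(n * (a₂ - δ)))) ≤
      hashFidelity (prodWeight n p) f := by
  classical
  set Q : R × A → ℝ := fun y => t y.1 * V y
  set c : R × A → ℝ := fun y => conditional p y.1 y.2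
  have hQ0 : ∀ y, 0 ≤ Q y := fun y => mul_nonneg (ht _) (hV _)
  set g : Fin 3 → R × A → ℝ := ![fun y => Real.logb 2 (Q y / p y),
    fun y => Real.logb 2 (V y / c y), fun y => Real.logb 2 (c y)] with hg
  change ∑ y, Q y * Real.logb 2 (Q y / p y) = a₁ at h₁
  change ∑ y, Q y * Real.logb 2 (V y / c y) = a₂ at h₂
  change ∑ y, Q y * Real.logb 2 (c y) = -a₃ at h₃
  filter_upwards [eventually_half_le_sum_typical hQ0 hQ g hδ] with n hn M _
  have hπ : ∀ y, 0 ≤ prodWeight n p y := fun y => Finset.prod_nonneg fun i _ => hp _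
  set S : Finset ((Fin n → R) × (Fin n → A)) :=
    Finset.univ.filter fun y => IsTypical Q g δ fun i => (y.1 i, y.2 i) with hS
  have hVpos : ∀ y, 0 < Q y → 0 < V y := fun y h => pos_of_mul_pos_right h (ht _)
  have hmpos : ∀ y, 0 < Q y → 0 < marginal p y.1 := fun y h =>
    (hsupp y h).trans_le (le_marginal hp y)
  have hcpos : ∀ y, 0 < Q y → 0 < c y := fun y h => div_pos (hsupp y h) (hmpos y h)
  have hfac : ∀ y : (Fin n → R) × (Fin n → A), prodWeight n p y =
      (∏ i, c (y.1 i, y.2 i)) * marginal (prodWeight n p) y.1 := by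
    intro y
    rw [marginal_prodWeight, ← Finset.prod_mul_distrib]
    exact Finset.prod_congr rfl fun i _ => by
      rw [mul_comm]
      exact (marginal_mul_conditional hp (y.1 i, y.2 i)).symm
  -- Typicality turns the three exponents into pointwise bounds on the products along `y`.
  have hS1 : ∀ y ∈ S, (2 : ℝ) ^ (-(n * (a₁ + δ))) * ∏ i, Q (y.1 i, y.2 i) ≤
      prodWeight n p y := by
    intro y hy
    obtain ⟨hpos, hty⟩ := (Finset.mem_filter.1 hy).2
    have h := (abs_le.1 (hty 0)).2
    simp only [hg, Matrix.cons_val_zero, h₁] at h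
    have e := prod_eq_rpow_sum_logb (h := fun y => Q y / p y) (w := fun i => (y.1 i, y.2 i))
      (fun i => div_pos (hpos i) (hsupp _ (hpos i)))
    have hpp : 0 < prodWeight n p y := Finset.prod_pos fun i _ => hsupp _ (hpos i)
    rw [Finset.prod_div_distrib, div_eq_iff (by exact hpp.ne')] at e
    rw [e, ← mul_assoc, ← Real.rpow_add two_pos]
    refine mul_le_of_le_one_left hpp.le (Real.rpow_le_one_of_one_le_of_nonpos one_le_two ?_)
    linarith
  have hS2 : ∀ y ∈ S, ∏ i, c (y.1 i, y.2 i) ≤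
      (2 : ℝ) ^ (-(n * (a₂ - δ))) * ∏ i, V (y.1 i, y.2 i) := by
    intro y hy
    obtain ⟨hpos, hty⟩ := (Finset.mem_filter.1 hy).2
    have h := (abs_le.1 (hty 1)).1
    simp only [hg, Matrix.cons_val_one, Matrix.cons_val_zero, h₂] at h
    have e := prod_eq_rpow_sum_logb (h := fun y => V y / c y) (w := fun i => (y.1 i, y.2 i))
      (fun i => div_pos (hVpos _ (hpos i)) (hcpos _ (hpos i)))
    have hpp : 0 < ∏ i, c (y.1 i, y.2 i) := Finset.prod_pos fun i _ => hcpos _ (hpos i)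
    rw [Finset.prod_div_distrib, div_eq_iff (by exact hpp.ne')] at e
    rw [e, ← mul_assoc, ← Real.rpow_add two_pos]
    refine le_mul_of_one_le_left hpp.le (Real.one_le_rpow one_le_two ?_)
    linarith
  have hS3 : ∀ y ∈ S, ∏ i, c (y.1 i, y.2 i) ≤ (2 : ℝ) ^ (-(n * (a₃ - δ))) := by
    intro y hy
    obtain ⟨hpos, hty⟩ := (Finset.mem_filter.1 hy).2
    have h := (abs_le.1 (hty 2)).2
    simp only [hg, Matrix.cons_val, h₃] at h
    rw [prod_eq_rpow_sum_logb (h := c) (w := fun i => (y.1 i, y.2 i))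
      (fun i => hcpos _ (hpos i))]
    refine Real.rpow_le_rpow_of_exponent_le one_le_two ?_
    linarith
  have hmass : 1 / 2 * (2 : ℝ) ^ (-(n * (a₁ + δ))) ≤ ∑ y ∈ S, prodWeight n p y := by
    have h : 1 / 2 ≤ ∑ y ∈ S, ∏ i, Q (y.1 i, y.2 i) := by
      refine hn.trans (le_of_eq ?_)
      rw [Finset.sum_filter, hS, Finset.sum_filter]
      exact (sum_word_pair (fun w => if IsTypical Q g δ w then ∏ i, Q (w i) else 0)).symm
    calc _ ≤ (∑ y ∈ S, ∏ i, Q (y.1 i, y.2 i)) * (2 : ℝ) ^ (-(n * (a₁ + δ))) := by gcongr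
      _ ≤ _ := by
        rw [mul_comm, Finset.mul_sum]
        exact Finset.sum_le_sum hS1
  obtain ⟨f, hf⟩ := exists_hashFidelity_ge (Z := Fin M) hπ S
    (ω := (2 : ℝ) ^ (-(n * (a₃ - δ)))) (K := (2 : ℝ) ^ (-(n * (a₂ - δ))))
    (by positivity) (by positivity)
    (fun y hy => by
      rw [hfac y]
      exact mul_le_mul_of_nonneg_right (hS3 y hy) (marginal_nonneg hπ _))
    (fun x => by
      have hle : ∀ b, (S : Set ((Fin n → R) × (Fin n → A))).indicator (prodWeight n p) (x, b) ≤
          (2 : ℝ) ^ (-(n * (a₂ - δ))) * marginal (prodWeight n p) x * ∏ i, V (x i, b i) := by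
        intro b
        by_cases hb : (x, b) ∈ S
        · rw [Set.indicator_of_mem (by exact_mod_cast hb), hfac]
          calc _ ≤ ((2 : ℝ) ^ (-(n * (a₂ - δ))) * ∏ i, V (x i, b i)) *
                marginal (prodWeight n p) x :=
                mul_le_mul_of_nonneg_right (hS2 _ hb) (marginal_nonneg hπ _)
            _ = _ := by ring
        · rw [Set.indicator_of_notMem (by exact_mod_cast hb)]
          exact mul_nonneg (mul_nonneg (by positivity) (marginal_nonneg hπ _))
            (Finset.prod_nonneg fun i _ => hV _)
      refine (Finset.sum_le_sum fun b _ => hle b).trans ?_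
      rw [← Finset.mul_sum]
      refine mul_le_of_le_one_right (mul_nonneg (by positivity) (marginal_nonneg hπ _)) ?_
      have : ∑ b : Fin n → A, ∏ i, V (x i, b i) = ∏ i, ∑ a, V (x i, a) := by
        rw [Finset.prod_univ_sum, Fintype.piFinset_univ]
      rw [this]
      exact Finset.prod_le_one (fun i _ => Finset.sum_nonneg fun a _ => hV _) fun i _ => hV1 _)
  refine ⟨f, le_trans ?_ hf⟩
  rw [Fintype.card_fin]
  gcongr

/-! ### Tilted distributions and the variational formula -/

section Tilting

variable {R A : Type*} [Fintype A]

/-- The power sum `∑ₐ p(a|x)^α`. -/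
def powerSum (p : R × A → ℝ) (α : ℝ) (x : R) : ℝ := ∑ a, conditional p x a ^ α

/-- The normalization `∑ₓ p(x) (∑ₐ p(a|x)^α)^{1/(2α)}`. -/
def tiltNorm [Fintype R] (p : R × A → ℝ) (α : ℝ) : ℝ :=
  ∑ x, marginal p x * powerSum p α x ^ (1 / (2 * α))

/-- The tilted distribution on `R`, proportional to `p(x) (∑ₐ p(a|x)^α)^{1/(2α)}`. -/
def tiltR [Fintype R] (p : R × A → ℝ) (α : ℝ) (x : R) : ℝ :=
  marginal p x * powerSum p α x ^ (1 / (2 * α)) / tiltNorm p α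

/-- The tilted conditional distribution `p(a|x)^α / ∑ₐ' p(a'|x)^α`; for `α ≠ 0` it vanishes
identically where `p(x) = 0`. -/
def tiltA (p : R × A → ℝ) (α : ℝ) (y : R × A) : ℝ :=
  conditional p y.1 y.2 ^ α / powerSum p α y.1

/-- The conditional Shannon entropy of the tilted distribution. -/
def tiltEntropy [Fintype R] (p : R × A → ℝ) (α : ℝ) : ℝ :=
  -∑ y, tiltR p α y.1 * tiltA p α y * Real.logb 2 (tiltA p α y)

/-- The exponent at a fixed order `α`, with the infimum over distributions on `R` evaluated. -/
def exponentAt [Fintype R] (p : R × A → ℝ) (r α : ℝ) : ℝ :=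
  (1 - α) / α * r - 2 * Real.logb 2 (tiltNorm p α)

lemma conditional_nonneg {p : R × A → ℝ} (hp : ∀ y, 0 ≤ p y) (x : R) (a : A) :
    0 ≤ conditional p x a := div_nonneg (hp _) (marginal_nonneg hp _)

lemma powerSum_nonneg {p : R × A → ℝ} (hp : ∀ y, 0 ≤ p y) (α : ℝ) (x : R) : 0 ≤ powerSum p α x :=
  Finset.sum_nonneg fun _ _ => Real.rpow_nonneg (conditional_nonneg hp _ _) _

lemma powerSum_pos {p : R × A → ℝ} (hp : ∀ y, 0 ≤ p y) (α : ℝ) {x : R} (hx : 0 < marginal p x) :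
    0 < powerSum p α x := by
  obtain ⟨a, -, ha⟩ := Finset.exists_ne_zero_of_sum_ne_zero hx.ne'
  have ha' : 0 < p (x, a) := lt_of_le_of_ne (hp _) ha.symm
  exact Finset.sum_pos' (fun _ _ => Real.rpow_nonneg (conditional_nonneg hp _ _) _)
    ⟨a, Finset.mem_univ a, Real.rpow_pos_of_pos (div_pos ha' hx) _⟩

lemma tiltA_nonneg {p : R × A → ℝ} (hp : ∀ y, 0 ≤ p y) (α : ℝ) (y : R × A) : 0 ≤ tiltA p α y :=
  div_nonneg (Real.rpow_nonneg (conditional_nonneg hp _ _) _) (powerSum_nonneg hp _ _)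

lemma sum_tiltA_le_one (p : R × A → ℝ) (α : ℝ) (x : R) : ∑ a, tiltA p α (x, a) ≤ 1 := by
  simp only [tiltA]
  rw [← Finset.sum_div]
  exact div_self_le_one _

lemma sum_tiltA {p : R × A → ℝ} (hp : ∀ y, 0 ≤ p y) (α : ℝ) {x : R} (hx : 0 < marginal p x) :
    ∑ a, tiltA p α (x, a) = 1 := by
  simp only [tiltA]
  rw [← Finset.sum_div]
  exact div_self (powerSum_pos hp α hx).ne'

/-- The order-dependent factor `(1-α)/α` cancels the pole of the Rényi entropy at `α = 1`. -/
lemma mul_renyiEntropy {p : R × A → ℝ} {α : ℝ} (hα : 0 < α)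
    {x : R} (hx : 0 < marginal p x) :
    (1 - α) / α * renyiEntropy α (conditional p x) = 1 / α * Real.logb 2 (powerSum p α x) := by
  rw [renyiEntropy]
  split_ifs with h
  · subst h
    have : powerSum p 1 x = 1 := by
      simp only [powerSum, conditional, Real.rpow_one]
      rw [← Finset.sum_div]
      exact div_self hx.ne'
    simp [this]
  · have : 1 - α ≠ 0 := sub_ne_zero.2 (Ne.symm h)
    rw [powerSum]
    field_simp

variable [Fintype R]

lemma sum_marginal (p : R × A → ℝ) : ∑ x, marginal p x = ∑ y, p y :=
  (Fintype.sum_prod_type _).symm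

variable {p : R × A → ℝ} (hp : p ∈ stdSimplex ℝ (R × A))
include hp

lemma exists_marginal_pos : ∃ x, 0 < marginal p x := by
  have h : ∑ x, marginal p x ≠ 0 := by
    rw [sum_marginal, hp.2]
    exact one_ne_zero
  obtain ⟨x, -, hx⟩ := Finset.exists_ne_zero_of_sum_ne_zero h
  exact ⟨x, lt_of_le_of_ne (marginal_nonneg hp.1 x) hx.symm⟩

lemma tiltNorm_pos (α : ℝ) : 0 < tiltNorm p α := by
  obtain ⟨x, hx⟩ := exists_marginal_pos hp
  exact Finset.sum_pos'
    (fun x _ => mul_nonneg (marginal_nonneg hp.1 x) (Real.rpow_nonneg (powerSum_nonneg hp.1 _ _) _))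
    ⟨x, Finset.mem_univ x, mul_pos hx (Real.rpow_pos_of_pos (powerSum_pos hp.1 α hx) _)⟩

lemma tiltR_pos (α : ℝ) {x : R} (hx : 0 < marginal p x) : 0 < tiltR p α x :=
  div_pos (mul_pos hx (Real.rpow_pos_of_pos (powerSum_pos hp.1 α hx) _)) (tiltNorm_pos hp α)

lemma tiltR_mem (α : ℝ) : tiltR p α ∈ stdSimplex ℝ R := by
  refine ⟨fun x => div_nonneg (mul_nonneg (marginal_nonneg hp.1 x)
    (Real.rpow_nonneg (powerSum_nonneg hp.1 _ _) _)) (tiltNorm_pos hp α).le, ?_⟩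
  simp only [tiltR]
  rw [← Finset.sum_div]
  exact div_self (tiltNorm_pos hp α).ne'

omit hp in
lemma tiltR_eq_zero (α : ℝ) {x : R} (hx : marginal p x = 0) : tiltR p α x = 0 := by
  simp [tiltR, hx]

lemma logb_tiltR (α : ℝ) {x : R} (hx : 0 < marginal p x) :
    Real.logb 2 (tiltR p α x) = Real.logb 2 (marginal p x) +
      1 / (2 * α) * Real.logb 2 (powerSum p α x) - Real.logb 2 (tiltNorm p α) := by
  have h := powerSum_pos hp.1 α hx
  rw [tiltR, Real.logb_div (by positivity) (tiltNorm_pos hp α).ne',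
    Real.logb_mul hx.ne' (by positivity), Real.logb_rpow_eq_mul_logb_of_pos h]

/-- The integrand of the variational formula in terms of the tilted distribution. -/
lemma logb_div_marginal_eq {α : ℝ} (hα : 0 < α) {x : R} (hx : 0 < marginal p x) {s : ℝ}
    (hs : 0 < s) :
    2 * Real.logb 2 (s / marginal p x) - (1 - α) / α * renyiEntropy α (conditional p x) =
      2 * Real.logb 2 (s / tiltR p α x) - 2 * Real.logb 2 (tiltNorm p α) := by
  rw [mul_renyiEntropy hα hx, Real.logb_div hs.ne' hx.ne',
    Real.logb_div hs.ne' (tiltR_pos hp α hx).ne', logb_tiltR hp α hx]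
  field_simp
  ring

/-- The objective of the variational formula is, up to a constant, twice the relative entropy with
respect to the tilted distribution. -/
lemma objective_eq {α : ℝ} (hα : 0 < α) (r : ℝ) {t : R → ℝ} (ht : t ∈ stdSimplex ℝ R)
    (hac : ∀ x, marginal p x = 0 → t x = 0) :
    2 * ∑ x, t x * Real.logb 2 (t x / marginal p x) +
      (1 - α) / α * (r - ∑ x, t x * renyiEntropy α (conditional p x)) =
      exponentAt p r α + 2 * ∑ x, t x * Real.logb 2 (t x / tiltR p α x) := by
  have hterm : ∀ x, 2 * (t x * Real.logb 2 (t x / marginal p x)) -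
      (1 - α) / α * (t x * renyiEntropy α (conditional p x)) =
      2 * (t x * Real.logb 2 (t x / tiltR p α x)) - t x * (2 * Real.logb 2 (tiltNorm p α)) := by
    intro x
    rcases (ht.1 x).eq_or_lt with h | h
    · simp [← h]
    · have hm : 0 < marginal p x :=
        lt_of_le_of_ne (marginal_nonneg hp.1 x) fun h0 => h.ne' (hac x h0.symm)
      linear_combination t x * logb_div_marginal_eq hp hα hm h
  have := Finset.sum_congr (rfl : (Finset.univ : Finset R) = Finset.univ) fun x _ => hterm x
  rw [Finset.sum_sub_distrib, Finset.sum_sub_distrib, ← Finset.mul_sum, ← Finset.mul_sum,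
    ← Finset.mul_sum, ← Finset.sum_mul, ht.2] at this
  rw [exponentAt]
  linear_combination this

/-- Gibbs' inequality. -/
lemma sum_mul_logb_div_tiltR_nonneg (α : ℝ) {t : R → ℝ}
    (ht : t ∈ stdSimplex ℝ R) (hac : ∀ x, marginal p x = 0 → t x = 0) :
    0 ≤ ∑ x, t x * Real.logb 2 (t x / tiltR p α x) := by
  have hln : 0 < Real.log 2 := Real.log_pos one_lt_two
  have h : ∀ x, (t x - tiltR p α x) / Real.log 2 ≤ t x * Real.logb 2 (t x / tiltR p α x) := by
    intro x
    rcases (ht.1 x).eq_or_lt with h | h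
    · rw [← h, zero_mul, zero_sub]
      exact div_nonpos_of_nonpos_of_nonneg (neg_nonpos.2 ((tiltR_mem hp α).1 x)) hln.le
    · have hm : 0 < marginal p x :=
        lt_of_le_of_ne (marginal_nonneg hp.1 x) fun h0 => h.ne' (hac x h0.symm)
      have hτ := tiltR_pos hp α hm
      have := Real.log_le_sub_one_of_pos (div_pos hτ h)
      rw [Real.logb, ← mul_div_assoc]
      refine div_le_div_of_nonneg_right ?_ hln.le
      rw [← inv_div, Real.log_inv]
      have h2 := mul_le_mul_of_nonneg_left this h.le
      rw [mul_sub, mul_div_cancel₀ _ h.ne'] at h2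
      linarith
  refine le_trans (le_of_eq ?_) (Finset.sum_le_sum fun x _ => h x)
  rw [← Finset.sum_div, Finset.sum_sub_distrib, ht.2, (tiltR_mem hp α).2, sub_self, zero_div]

/-- The infimum over distributions on `R` is attained at the tilted distribution. -/
lemma iInf_objective_eq {α : ℝ} (hα : 0 < α) (r : ℝ) :
    ⨅ t ∈ stdSimplex ℝ R, (2 * relEntropy t (marginal p) +
      (((1 - α) / α * (r - ∑ x, t x * renyiEntropy α (conditional p x)) : ℝ) : EReal)) =
      (exponentAt p r α : EReal) := by
  have hval : ∀ t ∈ stdSimplex ℝ R, (∀ x, marginal p x = 0 → t x = 0) →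
      2 * relEntropy t (marginal p) +
      (((1 - α) / α * (r - ∑ x, t x * renyiEntropy α (conditional p x)) : ℝ) : EReal) =
      ((exponentAt p r α + 2 * ∑ x, t x * Real.logb 2 (t x / tiltR p α x) : ℝ) : EReal) := by
    intro t ht hac
    rw [relEntropy, if_pos hac, ← objective_eq hp hα r ht hac, EReal.coe_add, EReal.coe_mul]
    rfl
  refine le_antisymm ?_ ?_
  · refine (iInf₂_le (tiltR p α) (tiltR_mem hp α)).trans ?_
    rw [hval _ (tiltR_mem hp α) fun x hx => tiltR_eq_zero α hx]
    have : ∀ x, tiltR p α x * Real.logb 2 (tiltR p α x / tiltR p α x) = 0 := by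
      intro x
      by_cases h : tiltR p α x = 0
      · simp [h]
      · simp [div_self h]
    simp [this]
  · refine le_iInf₂ fun t ht => ?_
    by_cases hac : ∀ x, marginal p x = 0 → t x = 0
    · rw [hval t ht hac, EReal.coe_le_coe_iff]
      linarith [sum_mul_logb_div_tiltR_nonneg hp α ht hac]
    · rw [relEntropy, if_neg hac, EReal.mul_top_of_pos (by norm_num), EReal.top_add_coe]
      exact le_top

lemma exponentFormula_eq (r : ℝ) :
    exponentFormula p r = ⨆ α ∈ Set.Icc (1 / 2 : ℝ) 1, (exponentAt p r α : EReal) := by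
  rw [exponentFormula]
  exact iSup_congr fun α => iSup_congr fun hα =>
    iInf_objective_eq hp (lt_of_lt_of_le (by norm_num) hα.1) r

lemma sum_tilt (α : ℝ) : ∑ y, tiltR p α y.1 * tiltA p α y = 1 := by
  rw [Fintype.sum_prod_type, ← (tiltR_mem hp α).2]
  refine Finset.sum_congr rfl fun x _ => ?_
  simp only
  rw [← Finset.mul_sum]
  rcases (marginal_nonneg hp.1 x).eq_or_lt with h | h
  · rw [tiltR_eq_zero α h.symm, zero_mul]
  · rw [sum_tiltA hp.1 α h, mul_one]

lemma pos_of_tilt_pos {α : ℝ} (hα : 0 < α) {y : R × A} (hy : 0 < tiltR p α y.1 * tiltA p α y) :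
    0 < p y := by
  refine lt_of_le_of_ne (hp.1 y) fun h => hy.ne' ?_
  have : conditional p y.1 y.2 = 0 := by
    rw [conditional, ← h, zero_div]
  rw [tiltA, this, Real.zero_rpow hα.ne', zero_div, mul_zero]

/-- The exponents of the tilted distribution: with `H` its conditional entropy, the divergences in
`eventually_exists_hashFidelity_ge` combine to the value of `exponentAt` up to the terms in
`r - H`. -/
lemma tilt_exponents {α : ℝ} (hα : 0 < α) :
    ∃ a₁ a₂ a₃ : ℝ,
      ∑ y, tiltR p α y.1 * tiltA p α y * Real.logb 2 (tiltR p α y.1 * tiltA p α y / p y) = a₁ ∧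
      ∑ y, tiltR p α y.1 * tiltA p α y *
        Real.logb 2 (tiltA p α y / conditional p y.1 y.2) = a₂ ∧
      ∑ y, tiltR p α y.1 * tiltA p α y * Real.logb 2 (conditional p y.1 y.2) = -a₃ ∧
      a₃ - a₂ = tiltEntropy p α ∧
      2 * a₁ - a₂ = (1 - α) / α * tiltEntropy p α - 2 * Real.logb 2 (tiltNorm p α) := by
  set Q : R × A → ℝ := fun y => tiltR p α y.1 * tiltA p α y with hQ
  have hQ0 : ∀ y, 0 ≤ Q y := fun y => mul_nonneg ((tiltR_mem hp α).1 _) (tiltA_nonneg hp.1 _ _)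
  have hfacts : ∀ y, 0 < Q y → 0 < p y ∧ 0 < marginal p y.1 ∧ 0 < conditional p y.1 y.2 := by
    intro y hy
    have h1 := pos_of_tilt_pos hp hα hy
    have h2 := h1.trans_le (le_marginal hp.1 y)
    exact ⟨h1, h2, div_pos h1 h2⟩
  have hV : ∀ y, 0 < Q y → Real.logb 2 (tiltA p α y) =
      α * Real.logb 2 (conditional p y.1 y.2) - Real.logb 2 (powerSum p α y.1) := by
    intro y hy
    obtain ⟨-, hm, hc⟩ := hfacts y hy
    rw [tiltA, Real.logb_div (by positivity) (powerSum_pos hp.1 α hm).ne',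
      Real.logb_rpow_eq_mul_logb_of_pos hc]
  have hVpos : ∀ y, 0 < Q y → 0 < tiltA p α y := fun y hy =>
    pos_of_mul_pos_right hy ((tiltR_mem hp α).1 _)
  set C := ∑ y, Q y * Real.logb 2 (conditional p y.1 y.2) with hC
  set N := ∑ y, Q y * Real.logb 2 (powerSum p α y.1) with hN
  have hH : tiltEntropy p α = N - α * C := by
    rw [tiltEntropy, hN, hC, Finset.mul_sum, ← Finset.sum_sub_distrib, ← Finset.sum_neg_distrib]
    refine Finset.sum_congr rfl fun y _ => ?_
    change -(Q y * _) = _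
    rcases (hQ0 y).eq_or_lt with h | h
    · simp [← h]
    · rw [hV y h]
      ring
  have h2 : ∑ y, Q y * Real.logb 2 (tiltA p α y / conditional p y.1 y.2) =
      (α - 1) * C - N := by
    rw [hN, hC, Finset.mul_sum, ← Finset.sum_sub_distrib]
    refine Finset.sum_congr rfl fun y _ => ?_
    rcases (hQ0 y).eq_or_lt with h | h
    · simp [← h]
    · rw [Real.logb_div (hVpos y h).ne' (hfacts y h).2.2.ne', hV y h]
      ring
  have h1 : ∑ y, Q y * Real.logb 2 (Q y / p y) =
      1 / (2 * α) * N - Real.logb 2 (tiltNorm p α) + ((α - 1) * C - N) := by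
    have hΨ : Real.logb 2 (tiltNorm p α) = ∑ y, Q y * Real.logb 2 (tiltNorm p α) := by
      rw [← Finset.sum_mul, sum_tilt hp, one_mul]
    rw [← h2, hN, hΨ, Finset.mul_sum, ← Finset.sum_sub_distrib, ← Finset.sum_add_distrib]
    refine Finset.sum_congr rfl fun y _ => ?_
    rcases (hQ0 y).eq_or_lt with h | h
    · simp [← h]
    · obtain ⟨hpy, hm, hc⟩ := hfacts y h
      have hlog : Real.logb 2 (p y) = Real.logb 2 (marginal p y.1) +
          Real.logb 2 (conditional p y.1 y.2) := by
        rw [← Real.logb_mul hm.ne' hc.ne', marginal_mul_conditional hp.1]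
      rw [Real.logb_div h.ne' hpy.ne', Real.logb_div (hVpos y h).ne' hc.ne', hlog,
        show Q y = tiltR p α y.1 * tiltA p α y from rfl,
        Real.logb_mul (tiltR_pos hp α hm).ne' (hVpos y h).ne', logb_tiltR hp α hm]
      ring
  refine ⟨_, _, -C, h1, h2, (neg_neg C).symm, ?_, ?_⟩
  · rw [hH]
    ring
  · rw [hH]
    field_simp
    ring

lemma continuousOn_tiltEntropy : ContinuousOn (tiltEntropy p) (Set.Ioi 0) := by
  have hpow : ∀ x, ContinuousOn (fun α => powerSum p α x) (Set.Ioi 0) := fun x =>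
    continuousOn_finsetSum _ fun a _ =>
      continuousOn_const.rpow continuousOn_id fun α hα => Or.inr hα
  have hexp : ContinuousOn (fun α : ℝ => 1 / (2 * α)) (Set.Ioi 0) :=
    continuousOn_const.div (continuousOn_const.mul continuousOn_id) fun α hα =>
      mul_ne_zero two_ne_zero (ne_of_gt hα)
  have hterm : ∀ x, ContinuousOn (fun α => marginal p x * powerSum p α x ^ (1 / (2 * α)))
      (Set.Ioi 0) := fun x =>
    continuousOn_const.mul ((hpow x).rpow hexp fun α hα =>
      Or.inr (one_div_pos.2 (mul_pos two_pos hα)))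
  have hnorm : ContinuousOn (tiltNorm p) (Set.Ioi 0) :=
    continuousOn_finsetSum _ fun x _ => hterm x
  refine (continuousOn_finsetSum _ fun y _ => ?_).neg
  rcases (hp.1 y).eq_or_lt with h | h
  · refine (continuousOn_const (c := (0 : ℝ))).congr fun α hα => ?_
    by_contra hne
    have : ¬ 0 < tiltR p α y.1 * tiltA p α y := fun h' =>
      (pos_of_tilt_pos hp hα h').ne h
    have h0 : tiltR p α y.1 * tiltA p α y = 0 :=
      le_antisymm (not_lt.1 this)
        (mul_nonneg ((tiltR_mem hp α).1 _) (tiltA_nonneg hp.1 _ _))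
    exact hne (by simp only [h0, zero_mul])
  · have hm : 0 < marginal p y.1 := h.trans_le (le_marginal hp.1 y)
    have hc : 0 < conditional p y.1 y.2 := div_pos h hm
    have hA : ContinuousOn (fun α => tiltA p α y) (Set.Ioi 0) :=
      (continuousOn_const.rpow continuousOn_id fun α hα => Or.inr hα).div (hpow _)
        fun α _ => (powerSum_pos hp.1 α hm).ne'
    refine (((hterm _).div hnorm fun α _ => (tiltNorm_pos hp α).ne').mul hA).mul ?_
    exact (hA.log fun α _ => (div_pos (Real.rpow_pos_of_pos hc α)
      (powerSum_pos hp.1 α hm)).ne').div_const _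

/-- The order at which the exponent is attained: the end point `1` or `1/2` where `r` lies outside
the range of the tilted entropies, and otherwise an order whose tilted entropy is `r`. -/
lemma exists_order (r : ℝ) : ∃ α ∈ Set.Icc (1 / 2 : ℝ) 1,
    max (r - tiltEntropy p α) 0 = (1 - α) / α * (r - tiltEntropy p α) := by
  rcases le_total r (tiltEntropy p 1) with h1 | h1
  · exact ⟨1, by norm_num, by rw [max_eq_right (by linarith)]; norm_num⟩
  rcases le_total (tiltEntropy p (1 / 2)) r with h2 | h2
  · exact ⟨1 / 2, by norm_num, by rw [max_eq_left (by linarith)]; norm_num⟩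
  obtain ⟨α, hα, h⟩ := intermediate_value_Icc' (by norm_num : (1 / 2 : ℝ) ≤ 1)
    ((continuousOn_tiltEntropy hp).mono fun α hα => lt_of_lt_of_le (by norm_num) hα.1) ⟨h1, h2⟩
  exact ⟨α, hα, by simp [h]⟩

/-- The converse bound for `n` copies. -/
lemma hashFidelity_prodWeight_le {α : ℝ} (hα : α ∈ Set.Icc (1 / 2 : ℝ) 1) (n M : ℕ) [NeZero M]
    (f : (Fin n → A) → Fin M) :
    hashFidelity (prodWeight n p) f ≤ (M : ℝ) ^ ((α - 1) / (2 * α)) * tiltNorm p α ^ n := by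
  classical
  have hα0 : 0 < α := lt_of_lt_of_le (by norm_num) hα.1
  have hπ : ∀ y, 0 ≤ prodWeight n p y := fun y => Finset.prod_nonneg fun i _ => hp.1 _
  refine (hashFidelity_le hπ f hα).trans (le_of_eq ?_)
  rw [Fintype.card_fin]
  congr 1
  rw [tiltNorm, Fintype.sum_pow]
  refine Finset.sum_congr rfl fun x _ => ?_
  have h1 : ∀ x, marginal p x * powerSum p α x ^ (1 / (2 * α)) =
      Real.sqrt (marginal p x) * (∑ a, p (x, a) ^ α) ^ (1 / (2 * α)) := by
    intro x
    have hm := marginal_nonneg hp.1 x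
    have : ∑ a, p (x, a) ^ α = marginal p x ^ α * powerSum p α x := by
      rw [powerSum, Finset.mul_sum]
      refine Finset.sum_congr rfl fun a _ => ?_
      rw [← Real.mul_rpow hm (conditional_nonneg hp.1 _ _)]
      rw [marginal_mul_conditional hp.1 (x, a)]
    rw [this, Real.mul_rpow (by positivity) (powerSum_nonneg hp.1 _ _), ← Real.rpow_mul hm,
      show α * (1 / (2 * α)) = 1 / 2 by field_simp, ← Real.sqrt_eq_rpow, ← mul_assoc,
      Real.mul_self_sqrt hm]
  simp only [h1]
  rw [Finset.prod_mul_distrib, marginal_prodWeight,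
    Real.finsetProd_rpow _ _ fun i _ => Finset.sum_nonneg fun a _ => Real.rpow_nonneg (hp.1 _) _,
    Finset.prod_univ_sum, Fintype.piFinset_univ]
  congr 1
  · rw [Real.sqrt_eq_rpow, ← Real.finsetProd_rpow _ _ fun i _ => marginal_nonneg hp.1 _]
    simp only [Real.sqrt_eq_rpow]
  · congr 1
    refine Finset.sum_congr rfl fun b _ => ?_
    rw [prodWeight, Real.finsetProd_rpow _ _ fun i _ => hp.1 _]

end Tilting

/-! ### The exponent of privacy amplification -/

lemma hashSize_le (r : ℝ) (n : ℕ) : (hashSize r n : ℝ) ≤ (2 : ℝ) ^ ((n : ℝ) * r) :=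
  Nat.floor_le (by positivity)

lemma one_le_two_rpow {r : ℝ} (hr : 0 ≤ r) (n : ℕ) : (1 : ℝ) ≤ (2 : ℝ) ^ ((n : ℝ) * r) :=
  Real.one_le_rpow one_le_two (by positivity)

lemma hashSize_pos {r : ℝ} (hr : 0 ≤ r) (n : ℕ) : 0 < hashSize r n :=
  Nat.floor_pos.2 (one_le_two_rpow hr n)

lemma two_rpow_sub_one_le_hashSize {r : ℝ} (hr : 0 ≤ r) (n : ℕ) :
    (2 : ℝ) ^ ((n : ℝ) * r - 1) ≤ hashSize r n := by
  have h1 := Nat.lt_floor_add_one ((2 : ℝ) ^ ((n : ℝ) * r))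
  have h2 : (1 : ℝ) ≤ hashSize r n := by exact_mod_cast hashSize_pos hr n
  rw [Real.rpow_sub two_pos, Real.rpow_one]
  change _ < (hashSize r n : ℝ) + 1 at h1
  linarith

section Performance

variable {R A : Type*} [Fintype R] [Fintype A] [DecidableEq R] [DecidableEq A]
  {p : R × A → ℝ} (hp : p ∈ stdSimplex ℝ (R × A)) {r : ℝ} (hr : 0 ≤ r)
include hp hr

omit [DecidableEq R] [DecidableEq A] hr in
lemma sum_prodWeight (n : ℕ) : ∑ y, prodWeight n p y = 1 := by
  simp only [prodWeight]
  rw [sum_word_pair (fun w => ∏ i, p (w i)), ← Fintype.sum_pow, hp.2, one_pow]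

/-- Together with `optimalDistance_le`, this expresses that `1 - ε` is the squared optimal fidelity
up to a factor of two. -/
lemma le_optimalDistance {n : ℕ} {U : ℝ}
    (hU : ∀ f : (Fin n → A) → Fin (hashSize r n), hashFidelity (prodWeight n p) f ≤ U) :
    1 - U ^ 2 ≤ optimalDistance (classicalState p) r n := by
  have : NeZero (hashSize r n) := ⟨(hashSize_pos hr n).ne'⟩
  refine le_ciInf fun f => ?_
  rw [purifiedDistance, fidelity_hash hp.1]
  have h0 := hashFidelity_nonneg (prodWeight n p) f
  have hle : hashFidelity (prodWeight n p) f ^ 2 ≤ U ^ 2 := pow_le_pow_left₀ h0 (hU f) 2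
  have h1 : hashFidelity (prodWeight n p) f ^ 2 ≤ 1 := pow_le_one₀ h0
    (hashFidelity_le_one (fun y => Finset.prod_nonneg fun i _ => hp.1 _) (sum_prodWeight hp n) f)
  refine (by linarith : 1 - U ^ 2 ≤ 1 - hashFidelity (prodWeight n p) f ^ 2).trans ?_
  refine Real.le_sqrt_of_sq_le ?_
  nlinarith [sq_nonneg (hashFidelity (prodWeight n p) f)]

lemma optimalDistance_le {n : ℕ} {L : ℝ} (hL : 0 ≤ L)
    (h : ∃ f : (Fin n → A) → Fin (hashSize r n), L ≤ hashFidelity (prodWeight n p) f) :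
    optimalDistance (classicalState p) r n ≤ 1 - L ^ 2 / 2 := by
  have : NeZero (hashSize r n) := ⟨(hashSize_pos hr n).ne'⟩
  obtain ⟨f, hf⟩ := h
  refine (ciInf_le (Set.finite_range _).bddBelow f).trans ?_
  rw [purifiedDistance, fidelity_hash hp.1]
  have hle : L ^ 2 ≤ hashFidelity (prodWeight n p) f ^ 2 := pow_le_pow_left₀ hL hf 2
  have h1 : hashFidelity (prodWeight n p) f ^ 2 ≤ 1 := pow_le_one₀ (hashFidelity_nonneg _ f)
    (hashFidelity_le_one (fun y => Finset.prod_nonneg fun i _ => hp.1 _) (sum_prodWeight hp n) f)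
  refine (?_ : _ ≤ 1 - hashFidelity (prodWeight n p) f ^ 2 / 2).trans (by linarith)
  rw [Real.sqrt_le_iff]
  constructor
  · linarith
  · nlinarith [sq_nonneg (hashFidelity (prodWeight n p) f ^ 2)]

lemma optimalDistance_lt_one (n : ℕ) : optimalDistance (classicalState p) r n < 1 := by
  have : NeZero (hashSize r n) := ⟨(hashSize_pos hr n).ne'⟩
  have hπ : ∀ y, 0 ≤ prodWeight n p y := fun y => Finset.prod_nonneg fun i _ => hp.1 _
  -- With `S` everything and `ω = K = 1`, the one-shot bound is positive.
  have h := exists_hashFidelity_ge (Z := Fin (hashSize r n)) hπ Finset.univ one_pos one_pos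
    (fun y _ => by rw [one_mul]; exact le_marginal hπ y)
    (fun x => by simp [marginal])
  rw [sum_prodWeight hp] at h
  have hL : 0 < 1 / Real.sqrt (Fintype.card (Fin (hashSize r n)) * 1 + 1) := by positivity
  have := optimalDistance_le hp hr hL.le h
  have := pow_pos hL 2
  linarith

/-- Every order `α` gives a lower bound; the loss `1/n` is that of rounding `2^{nr}` down. -/
lemma exponentAt_sub_le {α : ℝ} (hα : α ∈ Set.Icc (1 / 2 : ℝ) 1) {n : ℕ} (hn : 0 < n) :
    exponentAt p r α - 1 / n ≤
      -1 / (n : ℝ) * Real.logb 2 (1 - optimalDistance (classicalState p) r n) := by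
  have : NeZero (hashSize r n) := ⟨(hashSize_pos hr n).ne'⟩
  have hn0 : (0 : ℝ) < n := by exact_mod_cast hn
  have hα0 : 0 < α := lt_of_lt_of_le (by norm_num) hα.1
  have hM : (0 : ℝ) < hashSize r n := by exact_mod_cast hashSize_pos hr n
  have hΨ := tiltNorm_pos hp α
  have h1 := le_optimalDistance hp hr fun f =>
    hashFidelity_prodWeight_le hp hα n (hashSize r n) f
  have h2 : Real.logb 2 (1 - optimalDistance (classicalState p) r n) ≤
      Real.logb 2 (((hashSize r n : ℝ) ^ ((α - 1) / (2 * α)) * tiltNorm p α ^ n) ^ 2) :=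
    Real.logb_le_logb_of_le one_lt_two (by linarith [optimalDistance_lt_one hp hr n])
      (by linarith)
  rw [Real.logb_pow, Real.logb_mul (by positivity) (by positivity),
    Real.logb_rpow_eq_mul_logb_of_pos hM, Real.logb_pow] at h2
  have h3 : n * r - 1 ≤ Real.logb 2 (hashSize r n) := by
    rw [Real.le_logb_iff_rpow_le one_lt_two hM]
    exact two_rpow_sub_one_le_hashSize hr n
  have hs0 : 0 ≤ (1 - α) / α := div_nonneg (by linarith [hα.2]) hα0.le
  have hs1 : (1 - α) / α ≤ 1 := by
    rw [div_le_one hα0]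
    linarith [hα.1]
  have e : (α - 1) / (2 * α) = -((1 - α) / α) / 2 := by
    field_simp
    ring
  rw [e] at h2
  have h4 := mul_le_mul_of_nonneg_left h3 hs0
  push_cast at h2
  rw [exponentAt]
  have e2 : -1 / (n : ℝ) * Real.logb 2 (1 - optimalDistance (classicalState p) r n) =
      -Real.logb 2 (1 - optimalDistance (classicalState p) r n) / n := by ring
  rw [e2, le_div_iff₀ hn0, sub_mul, one_div_mul_cancel hn0.ne']
  linarith

/-- The upper bound from the typical words of the tilted distribution. -/
lemma eventually_le_exponentAt_add {α : ℝ} (hα : α ∈ Set.Icc (1 / 2 : ℝ) 1)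
    (hopt : max (r - tiltEntropy p α) 0 = (1 - α) / α * (r - tiltEntropy p α))
    {δ : ℝ} (hδ : 0 < δ) :
    ∀ᶠ n : ℕ in atTop,
      -1 / (n : ℝ) * Real.logb 2 (1 - optimalDistance (classicalState p) r n) ≤
        exponentAt p r α + δ := by
  have hα0 : 0 < α := lt_of_lt_of_le (by norm_num) hα.1
  obtain ⟨a₁, a₂, a₃, h₁, h₂, h₃, h₄, h₅⟩ := tilt_exponents hp hα0
  have hev := eventually_exists_hashFidelity_ge hp.1 (tiltR_mem hp α).1 (tiltA_nonneg hp.1 α)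
    (sum_tiltA_le_one p α) (sum_tilt hp α) (fun y => pos_of_tilt_pos hp hα0) h₁ h₂ h₃
    (δ := δ / 4) (by positivity)
  -- The slack is `3δ/4` from typicality and `4/n ≤ δ/4` from constant factors.
  filter_upwards [hev, eventually_gt_atTop 0, eventually_ge_atTop ⌈16 / δ⌉₊] with n hn hn0 hnδ
  have : NeZero (hashSize r n) := ⟨(hashSize_pos hr n).ne'⟩
  have hn0' : (0 : ℝ) < n := by exact_mod_cast hn0
  have hnδ' : 16 / δ ≤ n := (Nat.le_ceil _).trans (by exact_mod_cast hnδ)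
  rw [div_le_iff₀ hδ] at hnδ'
  set e := max (r - tiltEntropy p α) 0
  have he1 : r - tiltEntropy p α ≤ e := le_max_left _ _
  have he0 : 0 ≤ e := le_max_right _ _
  -- Since `a₃ = a₂ + H`, both summands under the root are at most `2^{n (e - a₂ + δ/4)}`.
  have hden : (hashSize r n : ℝ) * (2 : ℝ) ^ (-(n * (a₃ - δ / 4))) +
      (2 : ℝ) ^ (-(n * (a₂ - δ / 4))) ≤ (2 : ℝ) ^ (1 + n * (e - a₂ + δ / 4)) := by
    have hb1 : (hashSize r n : ℝ) * (2 : ℝ) ^ (-(n * (a₃ - δ / 4))) ≤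
        (2 : ℝ) ^ (n * (e - a₂ + δ / 4)) := by
      calc _ ≤ (2 : ℝ) ^ ((n : ℝ) * r) * (2 : ℝ) ^ (-(n * (a₃ - δ / 4))) := by
            gcongr
            exact hashSize_le r n
        _ = (2 : ℝ) ^ (n * (r - a₃ + δ / 4)) := by
            rw [← Real.rpow_add two_pos]
            congr 1
            ring
        _ ≤ _ := by
            refine Real.rpow_le_rpow_of_exponent_le one_le_two
              (mul_le_mul_of_nonneg_left ?_ hn0'.le)
            linarith
    have hb2 : (2 : ℝ) ^ (-(n * (a₂ - δ / 4))) ≤ (2 : ℝ) ^ (n * (e - a₂ + δ / 4)) := by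
      refine Real.rpow_le_rpow_of_exponent_le one_le_two ?_
      nlinarith
    rw [Real.rpow_add two_pos, Real.rpow_one]
    linarith
  have hL0 : 0 ≤ 1 / 2 * (2 : ℝ) ^ (-(n * (a₁ + δ / 4))) /
      Real.sqrt (hashSize r n * (2 : ℝ) ^ (-(n * (a₃ - δ / 4))) +
        (2 : ℝ) ^ (-(n * (a₂ - δ / 4)))) := by positivity
  have h6 := optimalDistance_le hp hr hL0 (hn (hashSize r n))
  have h7 : (2 : ℝ) ^ (-(4 + n * (2 * a₁ - a₂ + e + 3 * δ / 4))) ≤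
      1 - optimalDistance (classicalState p) r n := by
    refine le_trans ?_ (le_sub_comm.1 h6)
    rw [div_pow, Real.sq_sqrt (by positivity), mul_pow,
      ← Real.rpow_natCast ((2 : ℝ) ^ _) 2, ← Real.rpow_mul zero_le_two, div_div]
    calc (2 : ℝ) ^ (-(4 + n * (2 * a₁ - a₂ + e + 3 * δ / 4)))
        = (1 / 2) ^ 2 * (2 : ℝ) ^ (-(n * (a₁ + δ / 4)) * (2 : ℕ)) /
            ((2 : ℝ) ^ (1 + n * (e - a₂ + δ / 4)) * 2) := by
          have h4 : ((1 : ℝ) / 2) ^ 2 = (2 : ℝ) ^ (-2 : ℝ) := by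
            rw [Real.rpow_neg zero_le_two]
            norm_num
          rw [h4, ← Real.rpow_add_one two_ne_zero, ← Real.rpow_add two_pos,
            ← Real.rpow_sub two_pos]
          congr 1
          push_cast
          ring
      _ ≤ _ := by
          gcongr
  have h8 : -(4 + n * (2 * a₁ - a₂ + e + 3 * δ / 4)) ≤
      Real.logb 2 (1 - optimalDistance (classicalState p) r n) := by
    rw [Real.le_logb_iff_rpow_le one_lt_two (by linarith [optimalDistance_lt_one hp hr n])]
    exact h7
  have h9 : 2 * a₁ - a₂ + e = exponentAt p r α := by
    rw [exponentAt, h₅, hopt]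
    ring
  rw [h9] at h8
  have e2 : -1 / (n : ℝ) * Real.logb 2 (1 - optimalDistance (classicalState p) r n) =
      -Real.logb 2 (1 - optimalDistance (classicalState p) r n) / n := by ring
  rw [e2, div_le_iff₀ hn0']
  nlinarith

/-- The error exponent converges to its value at the order of `exists_order`. -/
lemma tendsto_exponentAt {α : ℝ} (hα : α ∈ Set.Icc (1 / 2 : ℝ) 1)
    (hopt : max (r - tiltEntropy p α) 0 = (1 - α) / α * (r - tiltEntropy p α)) :
    Tendsto (fun n : ℕ =>
      -1 / (n : ℝ) * Real.logb 2 (1 - optimalDistance (classicalState p) r n))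
      atTop (𝓝 (exponentAt p r α)) := by
  have hlow : Tendsto (fun n : ℕ => exponentAt p r α - 1 / (n : ℝ)) atTop
      (𝓝 (exponentAt p r α)) := by
    simpa using tendsto_const_nhds.sub (tendsto_one_div_atTop_nhds_zero_nat (𝕜 := ℝ))
  refine tendsto_order.2 ⟨fun b hb => ?_, fun b hb => ?_⟩
  · filter_upwards [hlow.eventually_const_lt hb, eventually_gt_atTop 0] with n h hn
    exact h.trans_le (exponentAt_sub_le hp hr hα hn)
  · filter_upwards [eventually_le_exponentAt_add hp hr hα hopt (half_pos (sub_pos.2 hb))]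
      with n h
    linarith

/-- The order of `exists_order` maximizes `exponentAt`, since all orders bound the same limit
from below. -/
lemma exponentAt_le {α β : ℝ} (hα : α ∈ Set.Icc (1 / 2 : ℝ) 1)
    (hopt : max (r - tiltEntropy p α) 0 = (1 - α) / α * (r - tiltEntropy p α))
    (hβ : β ∈ Set.Icc (1 / 2 : ℝ) 1) : exponentAt p r β ≤ exponentAt p r α := by
  have hlow : Tendsto (fun n : ℕ => exponentAt p r β - 1 / (n : ℝ)) atTop
      (𝓝 (exponentAt p r β)) := by
    simpa using tendsto_const_nhds.sub (tendsto_one_div_atTop_nhds_zero_nat (𝕜 := ℝ))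
  refine le_of_tendsto_of_tendsto hlow (tendsto_exponentAt hp hr hα hopt) ?_
  filter_upwards [eventually_gt_atTop 0] with n hn
  exact exponentAt_sub_le hp hr hβ hn

end Performance

end

end PrivacyAmplification


theorem theorem3 {R A : Type*} [Fintype R] [Fintype A] [DecidableEq R] [DecidableEq A]
    (p : R × A → ℝ) (hp : p ∈ stdSimplex ℝ (R × A)) (r : ℝ) (hr : 0 ≤ r) :
    (∀ n : ℕ, PrivacyAmplification.optimalDistance
      (PrivacyAmplification.classicalState p) r n < 1) ∧
    Tendsto
      (fun n : ℕ => ((-1 / (n : ℝ) * Real.logb 2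
        (1 - PrivacyAmplification.optimalDistance
          (PrivacyAmplification.classicalState p) r n) : ℝ) : EReal))
      atTop (𝓝 (PrivacyAmplification.exponentFormula p r)) := by
  refine ⟨PrivacyAmplification.optimalDistance_lt_one hp hr, ?_⟩
  obtain ⟨α, hα, hopt⟩ := PrivacyAmplification.exists_order hp r
  have hformula : PrivacyAmplification.exponentFormula p r =
      (PrivacyAmplification.exponentAt p r α : EReal) := by
    rw [PrivacyAmplification.exponentFormula_eq hp]
    refine le_antisymm (iSup₂_le fun β hβ => ?_)
      (le_iSup₂ (f := fun β _ => (PrivacyAmplification.exponentAt p r β : EReal)) α hα)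
    exact EReal.coe_le_coe_iff.2 (PrivacyAmplification.exponentAt_le hp hr hα hopt hβ)
  rw [hformula]
  exact (continuous_coe_real_ereal.tendsto _).comp
    (PrivacyAmplification.tendsto_exponentAt hp hr hα hopt)
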